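/- **Setting.** Let $K$ streams $X_k=(X_k(n))_{n\ge 1}$, $k\in[K]=\{1,\dots,K\}$, be independent, where $X_k$ has law $\mathrm P_k^1$ if $k$ is a signal and $\mathrm P_k^0$ if it is noise. For $A\subseteq[K]$, $\mathrm P_A$ is the product law when $A$ is the set of signals, and $\mathrm E_A$ is its expectation. Let $\mathcal F_k(n)$ (resp. $\mathcal F(n)$) be the $\sigma$-algebra generated by the first $n$ observations of stream $k$ (resp. of all streams). Assume that $\mathrm P_k^0$ and $\mathrm P_k^1$ are mutually absolutely continuous on $\mathcal F_k(n)$ for all $k,n$, and let $\lambda_k(n)=\log\frac{d\mathrm P_k^1}{d\mathrm P_k^0}(\mathcal F_k(n))$ be the log-likelihood ratio (LLR). Let $\lambda_{(1)}(n)\ge\dots\ge\lambda_{(K)}(n)$ be the ordered LLRs. A sequential multiple testing procedure $\chi=(\mathbf T,\mathbf D)$ consists of $(\mathcal F(n))$-stopping times $T_k\ge 1$ and a set $\mathbf D\subseteq [K]$ of streams identified as signals such that $\{T_k=n,\,k\in\mathbf D\}$ and $\{T_k=n,\,k\notin\mathbf D\}$ belong to $\mathcal F(n)$ for all $k,n$.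 For a class $\Pi$ of subsets of $[K]$ and $\alpha,\beta\in(0,1)$, $\Delta(\alpha,\beta,\Pi)$ is the set of such procedures with, for every $A\in\Pi$, $\mathrm P_A(T_k<\infty)=1$ for all $k$, $\mathrm P_A(\mathbf D\setminus A\ne\emptyset)\le\alpha$ and $\mathrm P_A(A\setminus\mathbf D\neq\emptyset)\le\beta$. Set $\mathcal L_{k,A}(\alpha,\beta,\Pi)=\inf\{\mathrm E_A[T_k]:(\mathbf T,\mathbf D)\in\Delta(\alpha,\beta,\Pi)\}$. Let $0\le l\le u\le K$, $u>0$, $l<K$, and $\Pi_{l,u}=\{A\subseteq[K]: l\le|A|\le u\}$. The proposed procedure $\hat\chi=(\hat{\mathbf T},\hat{\mathbf D})$ with thresholds $a,b,c,d>0$ has $\hat T_k=\min(\hat T_{k,1},\hat T_{k,2})$ and $\hat{\mathbf D}=\{k:\hat T_k=\hat T_{k,1}\}$, where, for $l<u$, $$\hat T_{k,1}=\inf\{n\ge1:\lambda_k(n)\ge\min(a,\lambda_{(l+1)}(n)+c)\},\qquad \hat T_{k,2}=\inf\{n\ge1:\lambda_k(n)\le\max(-b,\lambda_{(u)}(n)-d)\},$$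 and, for $l=u=m$, $$\hat T_{k,1}=\inf\{n\ge1:\lambda_k(n)\ge\lambda_{(m+1)}(n)+c\},\qquad \hat T_{k,2}=\inf\{n\ge1:\lambda_k(n)\le\lambda_{(m)}(n)-d\}.$$ For positive numbers $I_k,J_k$, $k\in[K]$, set $\mathcal I_A=\min_{i\in A}I_i$ and $\mathcal J_A=\min_{j\notin A}J_j$ ($\infty$ over the empty set, with $\infty\cdot0=0$). Write $f\sim g$ if $f/g\to1$ as $\alpha,\beta\downarrow0$ jointly, with no relation between $\alpha$ and $\beta$. **Theorem 4.1.** Suppose that for each $k\in[K]$ there are $I_k,J_k>0$ such that $$\mathrm P_k^1\Big(\limsup_n\tfrac{\lambda_k(n)}n\le I_k\Big)=1,\qquad \mathrm P_k^0\Big(\limsup_n\tfrac{-\lambda_k(n)}n\le J_k\Big)=1,$$ and, for every $\epsilon>0$, $$\sum_{n\ge1}\mathrm P_k^1\Big(\tfrac{\lambda_k(n)}n\le I_k-\epsilon\Big)<\infty,\qquad \sum_{n\ge1}\mathrm P_k^0\Big(\tfrac{-\lambda_k(n)}n\le J_k-\epsilon\Big)<\infty .$$ Let the thresholds $a,b,c,d>0$,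 as functions of $(\alpha,\beta)\in(0,1)^2$, be such that $\hat\chi\in\Delta(\alpha,\beta,\Pi_{l,u})$ for all $\alpha,\beta\in(0,1)$, and $a,c\sim|\log\alpha|$, $b,d\sim|\log\beta|$. Then, for every $A\in\Pi_{l,u}$, $i\in A$ and $j\notin A$, $$\mathrm E_A[\hat T_i]\sim\mathcal L_{i,A}(\alpha,\beta,\Pi_{l,u})\sim\frac{|\log\alpha|}{I_i+\mathcal J_A\mathbf 1\{|A|=l\}},\qquad \mathrm E_A[\hat T_j]\sim\mathcal L_{j,A}(\alpha,\beta,\Pi_{l,u})\sim\frac{|\log\beta|}{J_j+\mathcal I_A\mathbf 1\{|A|=u\}} .$$ Moreover, $\hat\chi\in\Delta(\alpha,\beta,\Pi_{l,u})$ for all $\alpha,\beta\in(0,1)$ with the following choices: if $l=u=m$, $c=|\log\alpha|+\log(m(K-m))$ and $d=|\log\beta|+\log(m(K-m))$; if $l<u$, $a=|\log\alpha|+\log K$, $b=|\log\beta|+\log K$, $c=|\log\alpha|+\log((K-l)K)$ and $d=|\log\beta|+\log(uK)$. -/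

import Mathlib

open MeasureTheory Filter Topology
open scoped ENNReal

noncomputable section

namespace SeqTest

/-! The observations of one stream with values in `S` form a sequence `x : ℕ → S`, in which `x t` is
the observation collected at time `t + 1`; times are `n = 1, 2, …`.  The sample space of `K` streams
is `∀ k, ℕ → S k`. -/

/-- The filtration of a single stream: at time `n`, the σ-algebra generated by its first `n`
observations. -/
def streamFiltration (S : Type*) [MeasurableSpace S] :
    Filtration ℕ (MeasurableSpace.pi : MeasurableSpace (ℕ → S)) where
  seq n := ⨆ (t : ℕ) (_ : t < n), MeasurableSpace.comap (fun x : ℕ → S => x t) inferInstance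
  mono' _ _ hmn := iSup₂_le fun t ht =>
    le_iSup₂ (f := fun (t : ℕ) (_ : t < _) =>
      MeasurableSpace.comap (fun x : ℕ → S => x t) inferInstance) t (lt_of_lt_of_le ht hmn)
  le' _ := iSup₂_le fun t _ => (measurable_pi_apply t).comap_le

section Streams

variable {K : ℕ} {S : Fin K → Type*} [∀ k, MeasurableSpace (S k)]

/-- The global filtration: at time `n`, the σ-algebra generated by the first `n` observations of
all the streams. -/
def globalFiltration (S : Fin K → Type*) [∀ k, MeasurableSpace (S k)] :
    Filtration ℕ (MeasurableSpace.pi : MeasurableSpace (∀ k, ℕ → S k)) where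
  seq n := ⨆ k, MeasurableSpace.comap (fun ω : ∀ k, ℕ → S k => ω k) (streamFiltration (S k) n)
  mono' _ _ hmn := iSup_mono fun k =>
    MeasurableSpace.comap_mono ((streamFiltration (S k)).mono hmn)
  le' n := iSup_le fun k => le_trans
    (MeasurableSpace.comap_mono ((streamFiltration (S k)).le n)) (measurable_pi_apply k).comap_le

/-- The joint distribution `P_A` of the independent streams when `A` is the set of signals:
stream `k` has law `P1 k` if `k ∈ A` and `P0 k` otherwise. -/
def jointLaw (P0 P1 : ∀ k, Measure (ℕ → S k)) (A : Finset (Fin K)) : Measure (∀ k, ℕ → S k) :=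
  Measure.pi fun k => if k ∈ A then P1 k else P0 k

/-- A pair `(T, D)` of decision times, possibly infinite, and of the set of streams that are
identified as signals. -/
structure Procedure (S : Fin K → Type*) where
  T : Fin K → (∀ k, ℕ → S k) → ℕ∞
  D : (∀ k, ℕ → S k) → Set (Fin K)

/-- `χ` is a sequential multiple testing procedure: each `T k` is a stopping time with values in
`{1, 2, …}` (or infinite) and each decision is measurable with respect to the observations
collected by time `T k`. -/
structure Procedure.IsSequential (χ : Procedure S) : Prop where
  one_le : ∀ k ω, 1 ≤ χ.T k ω
  stopping : ∀ k (n : ℕ), MeasurableSet[globalFiltration S n] {ω | χ.T k ω = n}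
  signal : ∀ k (n : ℕ), MeasurableSet[globalFiltration S n] {ω | χ.T k ω = n ∧ k ∈ χ.D ω}
  noise : ∀ k (n : ℕ), MeasurableSet[globalFiltration S n] {ω | χ.T k ω = n ∧ k ∉ χ.D ω}

/-- Type-I familywise error rate when `A` is the set of signals. -/
def FWE1 (P0 P1 : ∀ k, Measure (ℕ → S k)) (χ : Procedure S) (A : Finset (Fin K)) : ℝ≥0∞ :=
  jointLaw P0 P1 A {ω | (χ.D ω \ (A : Set (Fin K))).Nonempty}

/-- Type-II familywise error rate when `A` is the set of signals. -/
def FWE2 (P0 P1 : ∀ k, Measure (ℕ → S k)) (χ : Procedure S) (A : Finset (Fin K)) : ℝ≥0∞ :=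
  jointLaw P0 P1 A {ω | ((A : Set (Fin K)) \ χ.D ω).Nonempty}

/-- The sequential procedures that, for every `A` in the class `Pi`, terminate almost surely in
every stream under `P_A` and have familywise error rates at most `α` and `β`. -/
def errorClass (P0 P1 : ∀ k, Measure (ℕ → S k)) (α β : ℝ) (Pi : Set (Finset (Fin K))) :
    Set (Procedure S) :=
  {χ | χ.IsSequential ∧ ∀ A ∈ Pi, (∀ k, ∀ᵐ ω ∂(jointLaw P0 P1 A), χ.T k ω < ⊤) ∧
    FWE1 P0 P1 χ A ≤ ENNReal.ofReal α ∧ FWE2 P0 P1 χ A ≤ ENNReal.ofReal β}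

/-- The expected decision time `E_A[T k]`, in `[0, ∞]`. -/
def expectedTime (P0 P1 : ∀ k, Measure (ℕ → S k)) (χ : Procedure S) (k : Fin K)
    (A : Finset (Fin K)) : ℝ≥0∞ :=
  ∫⁻ ω, (χ.T k ω : ℝ≥0∞) ∂(jointLaw P0 P1 A)

/-- The optimal expected decision time in stream `k` when `A` is the set of signals. -/
def optimalTime (P0 P1 : ∀ k, Measure (ℕ → S k)) (k : Fin K) (A : Finset (Fin K)) (α β : ℝ)
    (Pi : Set (Finset (Fin K))) : ℝ≥0∞ :=
  ⨅ χ ∈ errorClass P0 P1 α β Pi, expectedTime P0 P1 χ k A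

/-- The sets of signals whose size is between `l` and `u`. -/
def boundedClass (K l u : ℕ) : Set (Finset (Fin K)) := {A | l ≤ A.card ∧ A.card ≤ u}

/-- The laws of a stream under the two hypotheses are mutually absolutely continuous on the
σ-algebra of the first `n` observations, for every `n`. -/
def LocallyEquivalent {S : Type*} [MeasurableSpace S] (P0 P1 : Measure (ℕ → S)) : Prop :=
  ∀ n : ℕ, P1.trim ((streamFiltration S).le n) ≪ P0.trim ((streamFiltration S).le n) ∧
    P0.trim ((streamFiltration S).le n) ≪ P1.trim ((streamFiltration S).le n)

/-- The log-likelihood ratio of a stream at time `n`: the logarithm of the Radon–Nikodym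
derivative of `P1` with respect to `P0`, both restricted to the first `n` observations. -/
def streamLLR {S : Type*} [MeasurableSpace S] (P0 P1 : Measure (ℕ → S)) (n : ℕ) :
    (ℕ → S) → ℝ :=
  llr (P1.trim ((streamFiltration S).le n)) (P0.trim ((streamFiltration S).le n))

/-- The vector of the log-likelihood ratios of all streams at time `n`. -/
def lam (P0 P1 : ∀ k, Measure (ℕ → S k)) (n : ℕ) (ω : ∀ k, ℕ → S k) : Fin K → ℝ :=
  fun k => streamLLR (P0 k) (P1 k) n (ω k)

/-- The `r`-th largest coordinate of `v`, for `1 ≤ r ≤ K` (and `0` for other `r`). -/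
def kthLargest (v : Fin K → ℝ) (r : ℕ) : ℝ :=
  if h : 1 ≤ r ∧ r ≤ K then v (Tuple.sort (fun k => -v k) ⟨r - 1, by omega⟩) else 0

/-- The first time `n ≥ 1` at which `p n` holds; it is infinite if there is none. -/
def firstTime (p : ℕ → Prop) : ℕ∞ := ⨅ (n : ℕ) (_ : 1 ≤ n ∧ p n), (n : ℕ∞)

/-- The time at which the proposed procedure would identify stream `k` as a signal. -/
def signalTime (P0 P1 : ∀ k, Measure (ℕ → S k)) (l u : ℕ) (a c : ℝ) (k : Fin K)
    (ω : ∀ k, ℕ → S k) : ℕ∞ :=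
  if l = u then
    firstTime fun n => kthLargest (lam P0 P1 n ω) (l + 1) + c ≤ lam P0 P1 n ω k
  else
    firstTime fun n => min a (kthLargest (lam P0 P1 n ω) (l + 1) + c) ≤ lam P0 P1 n ω k

/-- The time at which the proposed procedure would identify stream `k` as noise. -/
def noiseTime (P0 P1 : ∀ k, Measure (ℕ → S k)) (l u : ℕ) (b d : ℝ) (k : Fin K)
    (ω : ∀ k, ℕ → S k) : ℕ∞ :=
  if l = u then
    firstTime fun n => lam P0 P1 n ω k ≤ kthLargest (lam P0 P1 n ω) u - d
  else
    firstTime fun n => lam P0 P1 n ω k ≤ max (-b) (kthLargest (lam P0 P1 n ω) u - d)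

/-- The proposed procedure with thresholds `a, b, c, d`, given that the number of signals is between
`l` and `u`.  If `l = u`, then it does not depend on `a` and `b`. -/
def proposed (P0 P1 : ∀ k, Measure (ℕ → S k)) (l u : ℕ) (a b c d : ℝ) : Procedure S where
  T k ω := min (signalTime P0 P1 l u a c k ω) (noiseTime P0 P1 l u b d k ω)
  D ω := {k | min (signalTime P0 P1 l u a c k ω) (noiseTime P0 P1 l u b d k ω)
    = signalTime P0 P1 l u a c k ω}

/-- The one-sided strong laws:
`limsup λ(n) / n ≤ I` `P1`-almost surely and `limsup (-λ(n)) / n ≤ J` `P0`-almost surely. -/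
def LimsupCondition {S : Type*} [MeasurableSpace S] (P0 P1 : Measure (ℕ → S)) (I J : ℝ) : Prop :=
  (∀ᵐ x ∂P1, limsup (fun n : ℕ => ((streamLLR P0 P1 n x / n : ℝ) : EReal)) atTop ≤ (I : EReal)) ∧
  (∀ᵐ x ∂P0, limsup (fun n : ℕ => ((-streamLLR P0 P1 n x / n : ℝ) : EReal)) atTop ≤ (J : EReal))

/-- The one-sided complete convergence of `λ(n) / n` to `I` under `P1` and of `-λ(n) / n` to `J`
under `P0`; the sums are over the times `n + 1 = 1, 2, …`. -/
def CompleteConvergence {S : Type*} [MeasurableSpace S] (P0 P1 : Measure (ℕ → S)) (I J : ℝ) :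
    Prop :=
  ∀ ε : ℝ, 0 < ε →
    (∑' n : ℕ, P1 {x | streamLLR P0 P1 (n + 1) x / ((n + 1 : ℕ) : ℝ) ≤ I - ε} < ⊤) ∧
    (∑' n : ℕ, P0 {x | -streamLLR P0 P1 (n + 1) x / ((n + 1 : ℕ) : ℝ) ≤ J - ε} < ⊤)

end Streams

/-- The minimum of `I i` over `i ∈ A`; it is infinite if `A` is empty. -/
def minSignal {K : ℕ} (I : Fin K → ℝ) (A : Finset (Fin K)) : ℝ≥0∞ :=
  ⨅ i ∈ A, ENNReal.ofReal (I i)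

/-- The minimum of `J j` over `j ∉ A`; it is infinite if there is no such `j`. -/
def minNoise {K : ℕ} (J : Fin K → ℝ) (A : Finset (Fin K)) : ℝ≥0∞ :=
  ⨅ j ∉ A, ENNReal.ofReal (J j)

/-- `α` and `β` tend to `0` from above, independently of each other. -/
def levelsToZero : Filter (ℝ × ℝ) := 𝓝[>] (0 : ℝ) ×ˢ 𝓝[>] (0 : ℝ)

/-- `f ∼ g` as `α, β → 0`, for functions of `(α, β)` with values in `[0, ∞]`: the ratio tends to `1`.
As `∞ / ∞ = 0 / 0 = 0` and `x / 0 = ∞` for `x ≠ 0`, this forces `f` and `g` to be eventually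
positive and finite. -/
def Sim (f g : ℝ → ℝ → ℝ≥0∞) : Prop :=
  Tendsto (fun p : ℝ × ℝ => f p.1 p.2 / g p.1 p.2) levelsToZero (𝓝 1)

/-- `f ∼ g` as `α, β → 0`, for real functions of `(α, β)`. -/
def RealSim (f g : ℝ → ℝ → ℝ) : Prop :=
  Tendsto (fun p : ℝ × ℝ => f p.1 p.2 / g p.1 p.2) levelsToZero (𝓝 1)

end SeqTest

end

open SeqTest

/-!
For sets of signals `A` and `B`, the logarithm of the density of `P_B` with respect to `P_A` is
`∑ k ∈ B, λ k - ∑ k ∈ A, λ k`.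

*Error rates.* If stream `k ∉ A` is identified as a signal, then `λ k` exceeds `a`, or it exceeds
`λ i` by `c` for some `i ∈ A`. By Ville's inequality these events have `P_A`-probability at most
`exp (-a)` and `exp (-c)`, since `λ k` and `λ k - λ i` are the log-densities of the models in which
`k` is added to `A`, or replaces `i`.

*Lower bound.* A procedure which controls the errors under `P_A` and `P_B`, where `i ∈ A \ B`, has
to collect the evidence `|log α|` for `P_A` against `P_B` before it identifies `i` as a signal. The
evidence accumulates most slowly against `B = A \ {i}` or, if this set is too small, against
`B = A \ {i} ∪ {j}` with `J j` minimal; the rates are `I i` and `I i + min J`.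

*Upper bound.* By complete convergence, the expected number of times at which some log-likelihood
ratio is behind its drift is finite; at any other time past `|log α|` divided by the same rate,
stream `i` is identified as a signal.

Exchanging signals and noise, that is, `A` with `Aᶜ` and `λ` with `-λ`, yields the claims on noise.
-/

namespace SeqTest

section ChangeOfMeasure

variable {Ω : Type*} {m0 : MeasurableSpace Ω} {ℱ : Filtration ℕ m0} {P Q : Measure Ω}
  {L : ℕ → Ω → ℝ} {R : ℝ}

/-- On the σ-algebra `ℱ n`, the measure `Q` has density `exp (L n)` with respect to `P`. -/
def IsLogDensity (ℱ : Filtration ℕ m0) (P Q : Measure Ω) (L : ℕ → Ω → ℝ) : Prop :=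
  (∀ n, Measurable[ℱ n] (L n)) ∧
    ∀ n E, MeasurableSet[ℱ n] E → Q E = ∫⁻ ω in E, ENNReal.ofReal (Real.exp (L n ω)) ∂P

theorem IsLogDensity.measure_iUnion_le (h : IsLogDensity ℱ P Q L) {E : ℕ → Set Ω}
    (hE : ∀ n, MeasurableSet[ℱ n] (E n)) (hdisj : Pairwise (Function.onFun Disjoint E)) {C : ℝ}
    (hC : ∀ n, ∀ ω ∈ E n, L n ω ≤ C) :
    Q (⋃ n, E n) ≤ ENNReal.ofReal (Real.exp C) * P (⋃ n, E n) := by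
  have hE' n := ℱ.le n _ (hE n)
  rw [measure_iUnion hdisj hE', measure_iUnion hdisj hE', ← ENNReal.tsum_mul_left]
  refine ENNReal.tsum_le_tsum fun n => ?_
  rw [h.2 n _ (hE n), ← setLIntegral_const]
  exact setLIntegral_mono' (hE' n) fun ω hω => by gcongr; exact hC n ω hω

theorem IsLogDensity.measurableSet_le (h : IsLogDensity ℱ P Q L) (n : ℕ) (C : ℝ) :
    MeasurableSet[ℱ n] {ω | L n ω ≤ C} :=
  h.1 n measurableSet_Iic

/-- Ville's inequality. -/
theorem IsLogDensity.measure_exists_le [IsProbabilityMeasure P] (h : IsLogDensity ℱ P Q L)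
    (C : ℝ) : Q {ω | ∃ n, L n ω ≤ C} ≤ ENNReal.ofReal (Real.exp C) := by
  set E : ℕ → Set Ω := fun n => {ω | L n ω ≤ C}
  have hE : ∀ n, MeasurableSet[ℱ n] (disjointed E n) := fun n => by
    rw [disjointed_eq_inter_compl]
    exact (h.measurableSet_le n C).inter (MeasurableSet.iInter fun i => MeasurableSet.iInter
      fun hi => (ℱ.mono hi.le _ (h.measurableSet_le i C)).compl)
  calc Q {ω | ∃ n, L n ω ≤ C} = Q (⋃ n, disjointed E n) := by
        rw [iUnion_disjointed, Set.ofPred_exists]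
    _ ≤ ENNReal.ofReal (Real.exp C) * P (⋃ n, disjointed E n) :=
        h.measure_iUnion_le hE (disjoint_disjointed E) fun n _ hω => disjointed_subset E n hω
    _ ≤ ENNReal.ofReal (Real.exp C) := mul_le_of_le_one_right' prob_le_one

/-- While `L ≤ C`, events have at most `exp C` times their probability under `Q`. -/
theorem IsLogDensity.measure_le_of_decision (h : IsLogDensity ℱ Q P L) {T : Ω → ℕ∞} {G : Set Ω}
    (hTG : ∀ n : ℕ, MeasurableSet[ℱ n] {ω | T ω = n ∧ ω ∈ G}) (N : ℕ) (C : ℝ) :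
    P {ω | T ω ≤ N} ≤
      P Gᶜ + (P {ω | ∃ n ≤ N, C < L n ω} + ENNReal.ofReal (Real.exp C) * Q G) := by
  set E : ℕ → Set Ω := fun n => {ω | T ω = n ∧ ω ∈ G} ∩ {ω | L n ω ≤ C}
  have hdisj : Pairwise (Function.onFun Disjoint E) := fun i j hij =>
    Set.disjoint_left.2 fun ω hi hj => hij (by exact_mod_cast hi.1.1.symm.trans hj.1.1)
  have hsub : {ω | T ω ≤ N} ⊆ Gᶜ ∪ ({ω | ∃ n ≤ N, C < L n ω} ∪ ⋃ n, E n) := by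
    intro ω (hω : T ω ≤ N)
    obtain ⟨n, hn, hnN⟩ := ENat.le_natCast_iff.1 hω
    by_cases hG : ω ∈ G
    · rcases lt_or_ge C (L n ω) with hC | hC
      · exact Or.inr (Or.inl ⟨n, hnN, hC⟩)
      · exact Or.inr (Or.inr (Set.mem_iUnion.2 ⟨n, ⟨hn, hG⟩, hC⟩))
    · exact Or.inl hG
  calc P {ω | T ω ≤ N}
      ≤ P Gᶜ + (P {ω | ∃ n ≤ N, C < L n ω} + P (⋃ n, E n)) :=
        (measure_mono hsub).trans <| (measure_union_le _ _).trans <| by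
          gcongr; exact measure_union_le _ _
    _ ≤ P Gᶜ + (P {ω | ∃ n ≤ N, C < L n ω} + ENNReal.ofReal (Real.exp C) * Q (⋃ n, E n)) := by
        gcongr
        exact h.measure_iUnion_le (fun n => (hTG n).inter (h.measurableSet_le n C)) hdisj
          fun n ω hω => hω.2
    _ ≤ _ := by
        gcongr
        exact Set.iUnion_subset fun n ω hω => hω.1.2

/-- Almost surely under `P`, `limsup L n / n ≤ R`. -/
def GrowthAtMost (P : Measure Ω) (L : ℕ → Ω → ℝ) (R : ℝ) : Prop :=
  ∀ r > R, ∀ᵐ ω ∂P, ∀ᶠ n : ℕ in atTop, L n ω ≤ r * n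

theorem GrowthAtMost.add {L₁ L₂ : ℕ → Ω → ℝ} {R₁ R₂ : ℝ} (h₁ : GrowthAtMost P L₁ R₁)
    (h₂ : GrowthAtMost P L₂ R₂) : GrowthAtMost P (fun n ω => L₁ n ω + L₂ n ω) (R₁ + R₂) := by
  intro r hr
  filter_upwards [h₁ (R₁ + (r - (R₁ + R₂)) / 2) (by linarith),
    h₂ (R₂ + (r - (R₁ + R₂)) / 2) (by linarith)] with ω hω₁ hω₂
  filter_upwards [hω₁, hω₂] with n hn₁ hn₂
  linear_combination hn₁ + hn₂

theorem GrowthAtMost.tendsto_measure_exists_gt [IsFiniteMeasure P] (h : GrowthAtMost P L R)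
    (hL : ∀ n, Measurable (L n)) {r : ℝ} (hr : R < r) :
    Tendsto (fun k : ℕ => P {ω | ∃ n : ℕ, r * n + k < L n ω}) atTop (𝓝 0) := by
  set E : ℕ → Set Ω := fun k => {ω | ∃ n : ℕ, r * n + k < L n ω}
  have hE (k : ℕ) : MeasurableSet (E k) := by
    simp only [E, Set.ofPred_exists]
    exact MeasurableSet.iUnion fun n => measurableSet_lt measurable_const (hL n)
  have hanti : Antitone E := fun k k' hk ω ⟨n, hn⟩ => ⟨n, by
    have : (k : ℝ) ≤ k' := Nat.cast_le.2 hk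
    linarith⟩
  have hnull : P (⋂ k, E k) = 0 := by
    refine measure_mono_null ?_ (h r hr)
    intro ω hω hev
    have hbdd : IsBoundedUnder (· ≤ ·) atTop fun n : ℕ => L n ω - r * n :=
      ⟨0, eventually_map.2 (hev.mono fun n hn => sub_nonpos.2 hn)⟩
    obtain ⟨x, hx⟩ := hbdd.bddAbove_range
    obtain ⟨k, hk⟩ := exists_nat_ge x
    obtain ⟨n, hn⟩ := Set.mem_iInter.1 hω k
    linarith [hx ⟨n, rfl⟩]
  rw [← hnull]
  exact tendsto_measure_iInter_atTop (fun k => (hE k).nullMeasurableSet) hanti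
    ⟨0, measure_ne_top _ _⟩

theorem IsLogDensity.eventually_measure_le_of_decision [IsFiniteMeasure P]
    (h : IsLogDensity ℱ Q P L) (hL : GrowthAtMost P L R) (hR : 0 ≤ R) {ρ : ℝ} (hρ : 0 < ρ)
    (hρR : ρ * R < 1) {δ : ℝ≥0∞} (hδ : 0 < δ) :
    ∀ᶠ x : ℝ in atTop, ∀ (T : Ω → ℕ∞) (G : Set Ω),
      (∀ n : ℕ, MeasurableSet[ℱ n] {ω | T ω = n ∧ ω ∈ G}) →
      Q G ≤ ENNReal.ofReal (Real.exp (-x)) → P {ω | T ω ≤ ⌊ρ * x⌋₊} ≤ P Gᶜ + δ := by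
  obtain ⟨r, hRr, hr⟩ : ∃ r, R < r ∧ r < 1 / ρ :=
    exists_between ((lt_div_iff₀ hρ).2 (by linarith))
  have hρr : ρ * r < 1 := by rw [lt_div_iff₀ hρ] at hr; linarith
  have hδ2 : 0 < δ / 2 := ENNReal.half_pos hδ.ne'
  obtain ⟨k, hk⟩ := ((hL.tendsto_measure_exists_gt (fun n => (h.1 n).mono (ℱ.le n) le_rfl)
    hRr).eventually_le_const hδ2).exists
  have hexp : Tendsto (fun x : ℝ => ENNReal.ofReal (Real.exp (-((1 - ρ * r) * x - k)))) atTop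
      (𝓝 0) := by
    have h1 := (tendsto_id (α := ℝ)).const_mul_atTop (sub_pos.2 hρr)
    have h2 := Real.tendsto_exp_neg_atTop_nhds_zero.comp
      (tendsto_atTop_add_const_right _ (-k : ℝ) h1)
    simpa [sub_eq_add_neg] using ENNReal.tendsto_ofReal h2
  filter_upwards [hexp.eventually_le_const hδ2, eventually_ge_atTop 0] with x hx hx0 T G hTG hQ
  refine (h.measure_le_of_decision hTG ⌊ρ * x⌋₊ (ρ * r * x + k)).trans ?_
  rw [← ENNReal.add_halves δ]
  gcongr
  · refine (measure_mono ?_).trans hk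
    rintro ω ⟨n, hn, hLn⟩
    have hnx : (n : ℝ) ≤ ρ * x := (Nat.cast_le.2 hn).trans (Nat.floor_le (by positivity))
    exact ⟨n, by nlinarith⟩
  · calc ENNReal.ofReal (Real.exp (ρ * r * x + k)) * Q G
        ≤ ENNReal.ofReal (Real.exp (ρ * r * x + k)) * ENNReal.ofReal (Real.exp (-x)) := by gcongr
      _ = ENNReal.ofReal (Real.exp (-((1 - ρ * r) * x - k))) := by
        rw [← ENNReal.ofReal_mul (Real.exp_pos _).le, ← Real.exp_add]
        ring_nf
      _ ≤ δ / 2 := hx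

theorem ofReal_mul_one_sub_le_lintegral [IsProbabilityMeasure P] {T : Ω → ℕ∞} (hT : Measurable T)
    (y : ℝ) : ENNReal.ofReal y * (1 - P {ω | T ω ≤ ⌊y⌋₊}) ≤ ∫⁻ ω, (T ω : ℝ≥0∞) ∂P := by
  have hN : MeasurableSet {ω | T ω ≤ ⌊y⌋₊} := hT .of_discrete
  rw [← prob_compl_eq_one_sub hN]
  have hT' : Measurable fun ω => (T ω : ℝ≥0∞) :=
    (measurable_of_countable ENat.toENNReal).comp hT
  refine le_trans ?_ (mul_meas_ge_le_lintegral hT' (ENNReal.ofReal y))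
  gcongr
  intro ω hω
  have hω : (⌊y⌋₊ : ℕ∞) + 1 ≤ T ω := Order.add_one_le_of_lt (not_le.1 hω)
  calc ENNReal.ofReal y ≤ ENNReal.ofReal (⌊y⌋₊ + 1) := by gcongr; exact (Nat.lt_floor_add_one y).le
    _ = ((⌊y⌋₊ + 1 : ℕ∞) : ℝ≥0∞) := by norm_cast
    _ ≤ T ω := by gcongr

/-- The least expected time under `P` of a decision in favour of `P` whose error probabilities are
at most `α` under `Q` and `β` under `P`; the decision `G` is taken at time `T`. -/
noncomputable def minDecisionTime (ℱ : Filtration ℕ m0) (P Q : Measure Ω) (α β : ℝ) : ℝ≥0∞ :=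
  ⨅ (T : Ω → ℕ∞) (G : Set Ω) (_ : Measurable T ∧
    (∀ n : ℕ, MeasurableSet[ℱ n] {ω | T ω = n ∧ ω ∈ G}) ∧
    Q G ≤ ENNReal.ofReal α ∧ P Gᶜ ≤ ENNReal.ofReal β), ∫⁻ ω, (T ω : ℝ≥0∞) ∂P

theorem tendsto_abs_log_nhdsGT_zero : Tendsto (fun x => |Real.log x|) (𝓝[>] 0) atTop :=
  tendsto_abs_atBot_atTop.comp Real.tendsto_log_nhdsGT_zero

theorem IsLogDensity.eventually_le_minDecisionTime [IsProbabilityMeasure P]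
    (h : IsLogDensity ℱ Q P L) (hL : GrowthAtMost P L R) (hR : 0 < R) {s : ℝ} (hs0 : 0 < s)
    (hs1 : s < 1) : ∀ᶠ p : ℝ × ℝ in levelsToZero,
      ENNReal.ofReal (s * (|Real.log p.1| / R)) ≤ minDecisionTime ℱ P Q p.1 p.2 := by
  have hq0 : 0 < √s := Real.sqrt_pos.2 hs0
  have hq1 : √s < 1 := (Real.sqrt_lt' one_pos).2 (by rwa [one_pow])
  have hδ : 0 < ENNReal.ofReal ((1 - √s) / 2) := ENNReal.ofReal_pos.2 (by linarith)
  have hdecision := tendsto_abs_log_nhdsGT_zero.eventually <|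
    h.eventually_measure_le_of_decision hL hR.le (div_pos hq0 hR) (by field_simp; exact hq1) hδ
  have hα : ∀ᶠ α : ℝ in 𝓝[>] 0, α ∈ Set.Ioo (0 : ℝ) 1 := Ioo_mem_nhdsGT one_pos
  have hβ : ∀ᶠ β : ℝ in 𝓝[>] 0, β ≤ (1 - √s) / 2 :=
    (eventually_le_nhds (by linarith)).filter_mono nhdsWithin_le_nhds
  filter_upwards [tendsto_fst.eventually hdecision, tendsto_fst.eventually hα,
    tendsto_snd.eventually hβ] with ⟨α, β⟩ hαx ⟨hα0, hα1⟩ hβ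
  refine le_iInf₂ fun T G => le_iInf fun ⟨hT, hTG, hQ, hP⟩ => ?_
  have hexp : Real.exp (-|Real.log α|) = α := by
    rw [abs_of_neg (Real.log_neg hα0 hα1), neg_neg, Real.exp_log hα0]
  have herr : P {ω | T ω ≤ ⌊√s / R * |Real.log α|⌋₊} ≤ ENNReal.ofReal (1 - √s) :=
    calc _ ≤ P Gᶜ + ENNReal.ofReal ((1 - √s) / 2) := hαx T G hTG (by rwa [hexp])
      _ ≤ ENNReal.ofReal ((1 - √s) / 2) + ENNReal.ofReal ((1 - √s) / 2) := by
        gcongr; exact hP.trans (ENNReal.ofReal_le_ofReal hβ)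
      _ = ENNReal.ofReal (1 - √s) := by
        rw [← ENNReal.ofReal_add (by linarith) (by linarith), add_halves]
  calc ENNReal.ofReal (s * (|Real.log α| / R))
      = ENNReal.ofReal (√s / R * |Real.log α|) * (1 - ENNReal.ofReal (1 - √s)) := by
        rw [← ENNReal.ofReal_one, ← ENNReal.ofReal_sub _ (by linarith), sub_sub_cancel,
          ← ENNReal.ofReal_mul (by positivity)]
        congr 1
        linear_combination (-|Real.log α| / R) * Real.mul_self_sqrt hs0.le
    _ ≤ _ := by gcongr
    _ ≤ _ := ofReal_mul_one_sub_le_lintegral hT _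

theorem lintegral_le_of_lt_subset [IsProbabilityMeasure P] {T : Ω → ℕ∞} {B : ℕ → Set Ω}
    (hB : ∀ n, MeasurableSet (B n)) {M : ℕ}
    (h : ∀ n ω, M ≤ n → ((n + 1 : ℕ) : ℕ∞) < T ω → ω ∈ B n) :
    ∫⁻ ω, (T ω : ℝ≥0∞) ∂P ≤ M + 1 + ∑' n, P (B n) := by
  have hnat (ω : Ω) (m : ℕ) (hm : (m : ℕ∞) ≤ T ω) :
      (m : ℝ≥0∞) ≤ M + 1 + ∑' n, (B n).indicator 1 ω :=
    calc (m : ℝ≥0∞) ≤ M + 1 + ((m - 1 - M : ℕ) : ℝ≥0∞) := by norm_cast; omega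
      _ = M + 1 + ∑ n ∈ Finset.Ico M (m - 1), (B n).indicator 1 ω := by
        congr 1
        rw [Finset.sum_congr rfl (g := fun _ => 1), Finset.sum_const, Nat.card_Ico, nsmul_one]
        intro n hn
        rw [Finset.mem_Ico] at hn
        exact Set.indicator_of_mem (h n ω hn.1 (lt_of_lt_of_le (by norm_cast; omega) hm)) _
      _ ≤ _ := by gcongr; exact ENNReal.sum_le_tsum _
  have hpt (ω : Ω) : (T ω : ℝ≥0∞) ≤ M + 1 + ∑' n, (B n).indicator 1 ω := by
    specialize hnat ω
    generalize T ω = t at hnat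
    induction t using ENat.recTopCoe with
    | top => exact (ENNReal.eq_top_of_forall_nnreal_le fun x => by
        obtain ⟨m, hm⟩ := exists_nat_ge x
        exact le_trans (by exact_mod_cast hm) (hnat m le_top)).ge
    | coe m => exact hnat m le_rfl
  calc ∫⁻ ω, (T ω : ℝ≥0∞) ∂P ≤ ∫⁻ ω, (M + 1 + ∑' n, (B n).indicator 1 ω) ∂P := lintegral_mono hpt
    _ = M + 1 + ∑' n, P (B n) := by
      rw [lintegral_add_left measurable_const,
        lintegral_tsum fun n => (measurable_one.indicator (hB n)).aemeasurable]
      simp [lintegral_indicator_one (hB _)]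

end ChangeOfMeasure

section OrderStatistics

variable {K : ℕ}

theorem card_filter_sort (v w : Fin K → ℝ) (p : ℝ → Prop) [DecidablePred p] :
    (Finset.univ.filter fun i => p (v (Tuple.sort w i))).card =
      (Finset.univ.filter fun k => p (v k)).card := by
  simp only [Finset.card_filter]
  exact Equiv.sum_comp (Tuple.sort w) fun k => if p (v k) then 1 else 0

theorem le_kthLargest_iff (v : Fin K → ℝ) {r : ℕ} (h1 : 1 ≤ r) (hK : r ≤ K) (x : ℝ) :
    x ≤ kthLargest v r ↔ r ≤ (Finset.univ.filter fun k => x ≤ v k).card := by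
  have := Tuple.lt_card_le_iff_apply_le_of_monotone (j := ⟨r - 1, by omega⟩) (a := -x)
    (Tuple.monotone_sort fun k => -v k)
  simp only [Function.comp, neg_le_neg_iff] at this
  rw [kthLargest, dif_pos ⟨h1, hK⟩, ← this, card_filter_sort v _ (x ≤ ·)]
  omega

theorem lt_kthLargest_iff (v : Fin K → ℝ) {r : ℕ} (h1 : 1 ≤ r) (hK : r ≤ K) (x : ℝ) :
    x < kthLargest v r ↔ r ≤ (Finset.univ.filter fun k => x < v k).card := by
  have := Tuple.lt_card_lt_iff_apply_lt_of_monotone (j := ⟨r - 1, by omega⟩) (a := -x)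
    (Tuple.monotone_sort fun k => -v k)
  simp only [Function.comp, neg_lt_neg_iff] at this
  rw [kthLargest, dif_pos ⟨h1, hK⟩, ← this, card_filter_sort v _ (x < ·)]
  omega

theorem kthLargest_neg (v : Fin K → ℝ) {r : ℕ} (h1 : 1 ≤ r) (hK : r ≤ K) :
    kthLargest (-v) (K - r + 1) = -kthLargest v r := by
  refine eq_of_forall_le_iff fun x => ?_
  have hcard := Finset.card_filter_add_card_filter_not (s := Finset.univ) fun k => -x < v k
  have hsplit : (Finset.univ.filter fun k => x ≤ (-v) k) =
      Finset.univ.filter fun k => ¬ -x < v k :=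
    Finset.filter_congr fun k _ => by rw [not_lt, Pi.neg_apply, le_neg]
  rw [le_kthLargest_iff (-v) (by omega) (by omega), hsplit, le_neg,
    ← not_lt (a := -x), lt_kthLargest_iff v h1 hK]
  rw [Finset.card_univ, Fintype.card_fin] at hcard
  omega

theorem kthLargest_le {v : Fin K → ℝ} {A : Finset (Fin K)} {y : ℝ} {r : ℕ} (hr : A.card < r)
    (hK : r ≤ K) (h : ∀ j ∉ A, v j ≤ y) : kthLargest v r ≤ y := by
  by_contra! hlt
  rw [lt_kthLargest_iff v (by omega) hK] at hlt
  obtain ⟨k, hk, hkA⟩ := Finset.exists_mem_notMem_of_card_lt_card (hr.trans_le hlt)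
  exact (Finset.mem_filter.1 hk).2.not_ge (h k hkA)

theorem exists_mem_of_kthLargest_add_le {v : Fin K → ℝ} {A : Finset (Fin K)} {k : Fin K}
    (hk : k ∉ A) {m : ℕ} (hm : m ≤ A.card) {c : ℝ} (hc : 0 < c)
    (h : kthLargest v (m + 1) + c ≤ v k) : ∃ i ∈ A, c ≤ v k - v i := by
  by_contra! hA
  have hcard : m + 1 ≤ (insert k A).card := by rw [Finset.card_insert_of_notMem hk]; omega
  have hK : (insert k A).card ≤ K := by simpa using Finset.card_le_univ (insert k A)
  have hsub : insert k A ⊆ Finset.univ.filter fun i => v k - c < v i := fun i hi => by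
    rcases Finset.mem_insert.1 hi with rfl | hi
    · simpa using hc
    · simpa [sub_lt_comm] using hA i hi
  have := (lt_kthLargest_iff v (by omega) (hcard.trans hK) _).2
    (hcard.trans (Finset.card_le_card hsub))
  linarith

theorem measurable_kthLargest (r : ℕ) : Measurable fun v : Fin K → ℝ => kthLargest v r := by
  by_cases hr : 1 ≤ r ∧ r ≤ K
  · refine measurable_of_Ici fun x => ?_
    simp only [Set.preimage, Set.mem_Ici, le_kthLargest_iff _ hr.1 hr.2, Finset.card_filter]
    exact measurableSet_le measurable_const <| Finset.measurable_sum _ fun k _ =>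
      .ite (measurableSet_le measurable_const (measurable_pi_apply k)) measurable_const
        measurable_const
  · simp only [kthLargest, dif_neg hr]
    exact measurable_const

/-- Coordinate `k` of `v` is at least `a`, or exceeds the `(m + 1)`-th largest coordinate by at
least `c`. The value `a = ⊤` leaves the second criterion only. -/
def StandsOut (a : EReal) (c : ℝ) (m : ℕ) (v : Fin K → ℝ) (k : Fin K) : Prop :=
  a ≤ v k ∨ kthLargest v (m + 1) + c ≤ v k

theorem measurableSet_standsOut (a : EReal) (c : ℝ) (m : ℕ) (k : Fin K) :
    MeasurableSet {v : Fin K → ℝ | StandsOut a c m v k} :=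
  (measurableSet_le measurable_const (measurable_pi_apply k).coe_real_ereal).union <|
    measurableSet_le ((measurable_kthLargest _).add_const c) (measurable_pi_apply k)

end OrderStatistics

section FirstTime

theorem firstTime_le_iff {p : ℕ → Prop} {n : ℕ} :
    firstTime p ≤ n ↔ ∃ m ≤ n, 1 ≤ m ∧ p m := by
  constructor
  · contrapose!
    intro hp
    have : (n + 1 : ℕ∞) ≤ firstTime p := le_iInf₂ fun m hm => by
      norm_cast
      by_contra! hlt
      exact hp m (by omega) hm.1 hm.2
    exact (ENat.add_one_le_iff (ENat.natCast_ne_top n)).1 this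
  · rintro ⟨m, hm, h1, hp⟩
    exact (iInf₂_le m ⟨h1, hp⟩).trans (by exact_mod_cast hm)

theorem one_le_firstTime (p : ℕ → Prop) : 1 ≤ firstTime p :=
  le_iInf₂ fun m hm => by exact_mod_cast hm.1

theorem exists_of_firstTime_ne_top {p : ℕ → Prop} (h : firstTime p ≠ ⊤) : ∃ n, p n := by
  obtain ⟨n, hn⟩ := ENat.ne_top_iff_exists.1 h
  obtain ⟨m, -, -, hm⟩ := firstTime_le_iff.1 hn.ge
  exact ⟨m, hm⟩

theorem not_of_lt_firstTime {p : ℕ → Prop} {n : ℕ} (h1 : 1 ≤ n) (h : n < firstTime p) : ¬p n :=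
  fun hp => (firstTime_le_iff.2 ⟨n, le_rfl, h1, hp⟩).not_gt h

variable {Ω : Type*} {m0 : MeasurableSpace Ω} {ℱ : Filtration ℕ m0}

theorem isStoppingTime_firstTime {p : ℕ → Ω → Prop} (hp : ∀ n, MeasurableSet[ℱ n] {ω | p n ω}) :
    IsStoppingTime ℱ fun ω => firstTime fun n => p n ω := by
  intro n
  have : {ω | (firstTime fun n => p n ω) ≤ n} = ⋃ m ∈ Set.Icc 1 n, {ω | p m ω} := by
    ext ω
    simp [firstTime_le_iff, and_comm, and_left_comm]
  exact this ▸ .biUnion (Set.to_countable _) fun m hm => ℱ.mono hm.2 _ (hp m)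

end FirstTime

section LikelihoodModel

variable {K : ℕ} {Ω : Type*} {m0 : MeasurableSpace Ω} {ℱ : Filtration ℕ m0}
  {P : Finset (Fin K) → Measure Ω} {Λ : ℕ → Ω → Fin K → ℝ} {I J : Fin K → ℝ}
  {A : Finset (Fin K)} {i k : Fin K} {m : ℕ}

/-- `P A` is the law of the data when `A` is the set of signals, and `Λ n k` is the log-likelihood
ratio at time `n` of the streams being signals to their being noise. The streams `k ∈ A` and
`k ∉ A` play the same roles for `P` and `Λ` as `k ∉ A` and `k ∈ A` for `fun A => P Aᶜ` and `-Λ`. -/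
def IsLikelihoodModel (ℱ : Filtration ℕ m0) (P : Finset (Fin K) → Measure Ω)
    (Λ : ℕ → Ω → Fin K → ℝ) : Prop :=
  ∀ A B, IsLogDensity ℱ (P A) (P B) fun n ω => ∑ k ∈ B, Λ n ω k - ∑ k ∈ A, Λ n ω k

theorem IsLikelihoodModel.dual (h : IsLikelihoodModel ℱ P Λ) :
    IsLikelihoodModel ℱ (fun A => P Aᶜ) (-Λ) := by
  intro A B
  have hsum : (fun n ω => ∑ k ∈ B, (-Λ) n ω k - ∑ k ∈ A, (-Λ) n ω k) =
      fun n ω => ∑ k ∈ Bᶜ, Λ n ω k - ∑ k ∈ Aᶜ, Λ n ω k := by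
    ext n ω
    have hA := Finset.sum_add_sum_compl A (Λ n ω)
    have hB := Finset.sum_add_sum_compl B (Λ n ω)
    simp only [Pi.neg_apply, Finset.sum_neg_distrib]
    linarith
  exact hsum ▸ h Aᶜ Bᶜ

theorem IsLikelihoodModel.measurable (h : IsLikelihoodModel ℱ P Λ) (n : ℕ) :
    Measurable[ℱ n] (Λ n) :=
  @measurable_pi_lambda _ _ _ (ℱ n) _ _ fun k => by simpa using (h ∅ {k}).1 n

theorem IsLikelihoodModel.isStoppingTime_firstTime (h : IsLikelihoodModel ℱ P Λ) (a : EReal)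
    (c : ℝ) (m : ℕ) (k : Fin K) :
    IsStoppingTime ℱ fun ω => firstTime fun n => StandsOut a c m (Λ n ω) k :=
  SeqTest.isStoppingTime_firstTime fun n => h.measurable n (measurableSet_standsOut a c m k)

theorem sum_sub_sum_insert (v : Fin K → ℝ) (hk : k ∉ A) :
    ∑ j ∈ A, v j - ∑ j ∈ insert k A, v j = -v k := by
  rw [Finset.sum_insert hk]
  ring

theorem sum_sub_sum_erase (v : Fin K → ℝ) (hi : i ∈ A) :
    ∑ j ∈ A, v j - ∑ j ∈ A.erase i, v j = v i := by
  rw [← Finset.sum_erase_add A v hi]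
  ring

theorem sum_sub_sum_insert_erase (v : Fin K → ℝ) (hi : i ∈ A) (hk : k ∉ A) :
    ∑ j ∈ A, v j - ∑ j ∈ insert k (A.erase i), v j = v i - v k := by
  rw [Finset.sum_insert (fun h => hk (Finset.mem_of_mem_erase h)), ← Finset.sum_erase_add A v hi]
  ring

section Error

variable [∀ A, IsProbabilityMeasure (P A)]

theorem IsLikelihoodModel.measure_exists_threshold_le (h : IsLikelihoodModel ℱ P Λ) (hk : k ∉ A)
    (a : EReal) : P A {ω | ∃ n, a ≤ Λ n ω k} ≤ EReal.exp (-a) := by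
  induction a with
  | bot => simp
  | top => simp
  | coe a =>
    have := (h (insert k A) A).measure_exists_le (-a)
    simpa only [sum_sub_sum_insert _ hk, neg_le_neg_iff, EReal.coe_le_coe_iff, ← EReal.coe_neg,
      EReal.exp_coe] using this

theorem IsLikelihoodModel.measure_exists_gap_le (h : IsLikelihoodModel ℱ P Λ) (hi : i ∈ A)
    (hk : k ∉ A) (c : ℝ) :
    P A {ω | ∃ n, c ≤ Λ n ω k - Λ n ω i} ≤ ENNReal.ofReal (Real.exp (-c)) := by
  have := (h (insert k (A.erase i)) A).measure_exists_le (-c)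
  simpa only [sum_sub_sum_insert_erase _ hi hk, ← neg_sub (Λ _ _ k) (Λ _ _ i),
    neg_le_neg_iff] using this

theorem IsLikelihoodModel.measure_exists_standsOut_le (h : IsLikelihoodModel ℱ P Λ) (hk : k ∉ A)
    (hm : m ≤ A.card) {a : EReal} {c : ℝ} (hc : 0 < c) :
    P A {ω | ∃ n, StandsOut a c m (Λ n ω) k} ≤
      EReal.exp (-a) + A.card * ENNReal.ofReal (Real.exp (-c)) := by
  have hsub : {ω | ∃ n, StandsOut a c m (Λ n ω) k} ⊆
      {ω | ∃ n, a ≤ Λ n ω k} ∪ ⋃ i ∈ A, {ω | ∃ n, c ≤ Λ n ω k - Λ n ω i} := by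
    rintro ω ⟨n, hn | hn⟩
    · exact Or.inl ⟨n, hn⟩
    · obtain ⟨i, hi, hci⟩ := exists_mem_of_kthLargest_add_le hk hm hc hn
      exact Or.inr (Set.mem_biUnion hi ⟨n, hci⟩)
  refine (measure_mono hsub).trans <| (measure_union_le _ _).trans <|
    add_le_add (h.measure_exists_threshold_le hk a) ?_
  calc P A (⋃ i ∈ A, {ω | ∃ n, c ≤ Λ n ω k - Λ n ω i})
      ≤ ∑ i ∈ A, P A {ω | ∃ n, c ≤ Λ n ω k - Λ n ω i} := measure_biUnion_finset_le _ _
    _ ≤ A.card • ENNReal.ofReal (Real.exp (-c)) :=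
      Finset.sum_le_card_nsmul _ _ _ fun i hi => h.measure_exists_gap_le hi hk c
    _ = _ := nsmul_eq_mul _ _

theorem IsLikelihoodModel.measure_exists_notMem_standsOut_le (h : IsLikelihoodModel ℱ P Λ)
    (hm : m ≤ A.card) {a : EReal} {c : ℝ} (hc : 0 < c) :
    P A {ω | ∃ k ∉ A, ∃ n, StandsOut a c m (Λ n ω) k} ≤
      Aᶜ.card * (EReal.exp (-a) + A.card * ENNReal.ofReal (Real.exp (-c))) := by
  have hU : {ω | ∃ k ∉ A, ∃ n, StandsOut a c m (Λ n ω) k} =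
      ⋃ k ∈ Aᶜ, {ω | ∃ n, StandsOut a c m (Λ n ω) k} := by ext; simp
  rw [hU, ← nsmul_eq_mul]
  exact (measure_biUnion_finset_le _ _).trans <| Finset.sum_le_card_nsmul _ _ _ fun k hk =>
    h.measure_exists_standsOut_le (Finset.mem_compl.1 hk) hm hc

end Error

/-- The log-likelihood ratios of signals and the opposites of those of noise grow at rate at most
`I` and `J`, almost surely. -/
structure HasUpperRates (P : Finset (Fin K) → Measure Ω) (Λ : ℕ → Ω → Fin K → ℝ)
    (I J : Fin K → ℝ) : Prop where
  signal : ∀ A, ∀ k ∈ A, GrowthAtMost (P A) (fun n ω => Λ n ω k) (I k)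
  noise : ∀ A, ∀ k ∉ A, GrowthAtMost (P A) (fun n ω => -Λ n ω k) (J k)

theorem HasUpperRates.dual (h : HasUpperRates P Λ I J) :
    HasUpperRates (fun A => P Aᶜ) (-Λ) J I where
  signal A k hk := h.noise Aᶜ k (by simpa using hk)
  noise A k hk := by simpa using h.signal Aᶜ k (by simpa using hk)

/-- The log-likelihood ratios of signals and the opposites of those of noise grow at rate at least
`I` and `J`, in the sense of complete convergence; the sums are over the times `n + 1 ≥ 1`. -/
structure HasLowerRates (P : Finset (Fin K) → Measure Ω) (Λ : ℕ → Ω → Fin K → ℝ)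
    (I J : Fin K → ℝ) : Prop where
  signal : ∀ A, ∀ k ∈ A, ∀ ε > 0,
    ∑' n : ℕ, P A {ω | Λ (n + 1) ω k / (n + 1 : ℕ) ≤ I k - ε} < ⊤
  noise : ∀ A, ∀ k ∉ A, ∀ ε > 0,
    ∑' n : ℕ, P A {ω | -Λ (n + 1) ω k / (n + 1 : ℕ) ≤ J k - ε} < ⊤

theorem HasLowerRates.dual (h : HasLowerRates P Λ I J) :
    HasLowerRates (fun A => P Aᶜ) (-Λ) J I where
  signal A k hk := h.noise Aᶜ k (by simpa using hk)
  noise A k hk := by simpa using h.signal Aᶜ k (by simpa using hk)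

/-- The growth rate of the evidence that `i ∈ A` is a signal against its most favorable
alternative among the sets of at least `m` streams: noise in stream `i`, together with a signal in a
stream outside `A` if `A` has exactly `m` elements. -/
noncomputable def separationRate (I J : Fin K → ℝ) (m : ℕ) (A : Finset (Fin K)) (i : Fin K) : ℝ :=
  I i + if A.card = m then ⨅ j : {j // j ∉ A}, J j else 0

theorem exists_notMem_of_card_lt (h : A.card < K) : ∃ j, j ∉ A := by
  by_contra! hA
  rw [Finset.eq_univ_of_forall hA, Finset.card_univ, Fintype.card_fin] at h
  exact h.false

theorem exists_separationRate_eq (I J : Fin K → ℝ) (i : Fin K) (hA : A.card < K) :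
    ∃ j ∉ A, separationRate I J A.card A i = I i + J j := by
  obtain ⟨j, hj⟩ := exists_notMem_of_card_lt hA
  have : Nonempty {j // j ∉ A} := ⟨j, hj⟩
  obtain ⟨j, hj⟩ := exists_eq_ciInf_of_finite (f := fun j : {j // j ∉ A} => J j)
  exact ⟨j, j.2, by rw [separationRate, if_pos rfl, hj]⟩

theorem separationRate_le (I J : Fin K → ℝ) (i : Fin K) {j : Fin K} (hj : j ∉ A) :
    separationRate I J A.card A i ≤ I i + J j := by
  rw [separationRate, if_pos rfl]
  gcongr
  exact ciInf_le (Set.finite_range _).bddBelow (⟨j, hj⟩ : {j // j ∉ A})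

theorem separationRate_of_card_ne (I J : Fin K → ℝ) (i : Fin K) (hA : A.card ≠ m) :
    separationRate I J m A i = I i := by
  rw [separationRate, if_neg hA, add_zero]

theorem separationRate_pos (hI : ∀ k, 0 < I k) (hJ : ∀ k, 0 < J k) (hm : m < K) :
    0 < separationRate I J m A i := by
  rcases eq_or_ne A.card m with rfl | hA
  · obtain ⟨j, -, hj⟩ := exists_separationRate_eq I J i hm
    exact hj ▸ add_pos (hI i) (hJ j)
  · exact separationRate_of_card_ne I J i hA ▸ hI i

theorem ofReal_separationRate (hI : ∀ k, 0 < I k) (hJ : ∀ k, 0 < J k) (hm : m < K) :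
    ENNReal.ofReal (separationRate I J m A i) =
      ENNReal.ofReal (I i) + minNoise J A * if A.card = m then 1 else 0 := by
  rcases eq_or_ne A.card m with rfl | hA
  · obtain ⟨j, hjA, hj⟩ := exists_separationRate_eq I J i hm
    have hmin : minNoise J A = ENNReal.ofReal (J j) := by
      refine le_antisymm (iInf₂_le j hjA) (le_iInf₂ fun k hk => ENNReal.ofReal_le_ofReal ?_)
      linarith [separationRate_le I J i hk]
    rw [hj, ENNReal.ofReal_add (hI i).le (hJ j).le, hmin, if_pos rfl, mul_one]
  · rw [separationRate_of_card_ne I J i hA, if_neg hA, mul_zero, add_zero]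

theorem HasUpperRates.exists_alternative (h : HasUpperRates P Λ I J) (hi : i ∈ A)
    (hm : m ≤ A.card) (hmK : m < K) : ∃ B : Finset (Fin K), i ∉ B ∧ m ≤ B.card ∧ B.card ≤ A.card ∧
      GrowthAtMost (P A) (fun n ω => ∑ k ∈ A, Λ n ω k - ∑ k ∈ B, Λ n ω k)
        (separationRate I J m A i) := by
  have hcard := Finset.card_erase_add_one hi
  rcases hm.eq_or_lt with rfl | hm
  · obtain ⟨j, hj, hR⟩ := exists_separationRate_eq I J i hmK
    have hcard' : (insert j (A.erase i)).card = A.card := by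
      rw [Finset.card_insert_of_notMem fun h => hj (Finset.mem_of_mem_erase h), hcard]
    refine ⟨insert j (A.erase i), ?_, hcard'.ge, hcard'.le, ?_⟩
    · simp [ne_of_mem_of_not_mem hi hj]
    · simpa only [hR, sum_sub_sum_insert_erase _ hi hj, sub_eq_add_neg]
        using (h.signal A i hi).add (h.noise A j hj)
  · refine ⟨A.erase i, Finset.notMem_erase i A, by omega, by omega, ?_⟩
    simpa only [sum_sub_sum_erase _ hi, separationRate_of_card_ne I J i hm.ne']
      using h.signal A i hi

theorem standsOut_of_drift {v : Fin K → ℝ} {ε t h c : ℝ} {a : EReal} (hε : 0 ≤ ε) (ht : 0 ≤ t)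
    (hA : ∀ k ∈ A, (I k - ε) * t ≤ v k) (hAc : ∀ k ∉ A, (J k - ε) * t ≤ -v k) (hi : i ∈ A)
    (hmK : m < K) (hh : h ≤ (separationRate I J m A i - 2 * ε) * t) (ha : A.card ≠ m → a ≤ h)
    (hc : c ≤ h) : StandsOut a c m v i := by
  rcases eq_or_ne A.card m with rfl | hm
  · have hle : kthLargest v (A.card + 1) ≤ (I i + ε - separationRate I J A.card A i) * t :=
      kthLargest_le A.card.lt_succ_self hmK fun j hj => by
        linarith [hAc j hj, mul_le_mul_of_nonneg_right (separationRate_le I J i hj) ht]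
    exact Or.inr (by linarith [hA i hi])
  · rw [separationRate_of_card_ne I J i hm] at hh
    refine Or.inl ((ha hm).trans (EReal.coe_le_coe ?_))
    linarith [hA i hi, mul_nonneg hε ht]

theorem HasLowerRates.exists_drift (h : HasLowerRates P Λ I J)
    (hΛ : ∀ n, Measurable (Λ n)) (A : Finset (Fin K)) {ε : ℝ} (hε : 0 < ε) :
    ∃ B : ℕ → Set Ω, (∀ n, MeasurableSet (B n)) ∧ ∑' n, P A (B n) < ⊤ ∧ ∀ n, ∀ ω ∉ B n,
      (∀ k ∈ A, (I k - ε) * (n + 1 : ℕ) ≤ Λ (n + 1) ω k) ∧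
      ∀ k ∉ A, (J k - ε) * (n + 1 : ℕ) ≤ -Λ (n + 1) ω k := by
  set B : Fin K → ℕ → Set Ω := fun k n =>
    if k ∈ A then {ω | Λ (n + 1) ω k / (n + 1 : ℕ) ≤ I k - ε}
    else {ω | -Λ (n + 1) ω k / (n + 1 : ℕ) ≤ J k - ε} with hB
  refine ⟨fun n => ⋃ k, B k n, fun n => .iUnion fun k => ?_, ?_, fun n ω hω => ?_⟩
  · have hk : Measurable fun ω => Λ (n + 1) ω k := (measurable_pi_apply k).comp (hΛ (n + 1))
    simp only [hB]
    split_ifs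
    · exact measurableSet_le (hk.div_const _) measurable_const
    · exact measurableSet_le (hk.neg.div_const _) measurable_const
  · calc ∑' n, P A (⋃ k, B k n) ≤ ∑' n, ∑ k, P A (B k n) :=
          ENNReal.tsum_le_tsum fun n => measure_iUnion_fintype_le _ _
      _ = ∑ k, ∑' n, P A (B k n) := Summable.tsum_finsetSum fun _ _ => ENNReal.summable
      _ < ⊤ := ENNReal.sum_lt_top.2 fun k _ => by
        by_cases hk : k ∈ A
        · simpa only [hB, if_pos hk] using h.signal A k hk ε hε
        · simpa only [hB, if_neg hk] using h.noise A k hk ε hε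
  · have hn : (0 : ℝ) < (n + 1 : ℕ) := by positivity
    rw [Set.mem_iUnion, not_exists] at hω
    constructor <;> intro k hk <;> have hk' := hω k
    · simp only [hB, if_pos hk, Set.mem_ofPred_eq, not_le, lt_div_iff₀ hn] at hk'
      exact hk'.le
    · simp only [hB, if_neg hk, Set.mem_ofPred_eq, not_le, lt_div_iff₀ hn] at hk'
      exact hk'.le

theorem HasLowerRates.exists_lintegral_firstTime_le [IsProbabilityMeasure (P A)]
    (h : HasLowerRates P Λ I J) (hΛ : ∀ n, Measurable (Λ n)) (hi : i ∈ A) (hmK : m < K) {ρ : ℝ}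
    (hρ0 : 0 < ρ) (hρ : ρ < separationRate I J m A i) :
    ∃ C : ℝ≥0∞, C ≠ ⊤ ∧ ∀ (a : EReal) (c x : ℝ), 0 ≤ x → (A.card ≠ m → a ≤ x) → c ≤ x →
      ∫⁻ ω, (firstTime fun n => StandsOut a c m (Λ n ω) i : ℝ≥0∞) ∂P A ≤
        ENNReal.ofReal (x / ρ) + C := by
  set ε := (separationRate I J m A i - ρ) / 2 with hε_def
  have hε : 0 < ε := by linarith
  obtain ⟨B, hBm, hB, hdrift⟩ := h.exists_drift hΛ A hε
  refine ⟨1 + ∑' n, P A (B n), ENNReal.add_ne_top.2 ⟨ENNReal.one_ne_top, hB.ne⟩,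
    fun a c x hx ha hc => ?_⟩
  have hlate (n : ℕ) (ω : Ω) (hn : ⌊x / ρ⌋₊ ≤ n)
      (hT : ((n + 1 : ℕ) : ℕ∞) < firstTime fun n => StandsOut a c m (Λ n ω) i) : ω ∈ B n := by
    by_contra hω
    have hxn : x ≤ (separationRate I J m A i - 2 * ε) * (n + 1 : ℕ) := by
      rw [show separationRate I J m A i - 2 * ε = ρ by ring, ← div_le_iff₀' hρ0]
      exact (Nat.lt_of_floor_lt (Nat.lt_succ_of_le hn)).le
    exact not_of_lt_firstTime (by omega) hT <| standsOut_of_drift hε.le (Nat.cast_nonneg _)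
      (hdrift n ω hω).1 (hdrift n ω hω).2 hi hmK hxn ha hc
  calc _ ≤ ((⌊x / ρ⌋₊ : ℕ) : ℝ≥0∞) + 1 + ∑' n, P A (B n) :=
        lintegral_le_of_lt_subset hBm hlate
    _ ≤ ENNReal.ofReal (x / ρ) + (1 + ∑' n, P A (B n)) := by
      rw [add_assoc, ← ENNReal.ofReal_natCast]
      gcongr
      exact Nat.floor_le (by positivity)

theorem ae_firstTime_standsOut_lt_top [∀ A, IsProbabilityMeasure (P A)]
    (hP : IsLikelihoodModel ℱ P Λ) (h : HasLowerRates P Λ I J) (hI : ∀ k, 0 < I k)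
    (hJ : ∀ k, 0 < J k) (hi : i ∈ A) (hmK : m < K) {a : EReal} (ha : A.card ≠ m → a < ⊤) (c : ℝ) :
    ∀ᵐ ω ∂P A, (firstTime fun n => StandsOut a c m (Λ n ω) i) < ⊤ := by
  have hrate : 0 < separationRate I J m A i := separationRate_pos hI hJ hmK
  obtain ⟨C, hC, hle⟩ := h.exists_lintegral_firstTime_le
    (fun n => (hP.measurable n).mono (ℱ.le n) le_rfl) hi hmK (half_pos hrate) (half_lt_self hrate)
  have hfin := hle a c (max |a.toReal| c) (le_max_of_le_left (abs_nonneg _))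
    (fun hA => (EReal.le_coe_toReal (ha hA).ne).trans
      (EReal.coe_le_coe ((le_abs_self _).trans (le_max_left _ _)))) (le_max_right _ _)
  have hmeas : Measurable fun ω => firstTime fun n => StandsOut a c m (Λ n ω) i :=
    ENat.measurable_iff.2 fun n =>
      ℱ.le n _ ((hP.isStoppingTime_firstTime a c m i).measurableSet_eq n)
  filter_upwards [ae_lt_top ((measurable_of_countable ENat.toENNReal).comp hmeas)
    (hfin.trans_lt (ENNReal.add_lt_top.2 ⟨ENNReal.ofReal_lt_top, hC.lt_top⟩)).ne] with ω hω
  exact ENat.toENNReal_lt_top.1 hω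

end LikelihoodModel

section Asymptotics

theorem tendsto_swap_levelsToZero : Tendsto Prod.swap levelsToZero levelsToZero :=
  tendsto_snd.prodMk tendsto_fst

theorem Sim.swap {f g : ℝ → ℝ → ℝ≥0∞} (h : Sim f g) :
    Sim (fun α β => f β α) fun α β => g β α :=
  Tendsto.comp (g := fun p : ℝ × ℝ => f p.1 p.2 / g p.1 p.2) h tendsto_swap_levelsToZero

theorem RealSim.swap {f g : ℝ → ℝ → ℝ} (h : RealSim f g) :
    RealSim (fun α β => f β α) fun α β => g β α :=
  Tendsto.comp (g := fun p : ℝ × ℝ => f p.1 p.2 / g p.1 p.2) h tendsto_swap_levelsToZero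

theorem RealSim.eventually_le {f g : ℝ → ℝ → ℝ} (h : RealSim f g)
    (hg : ∀ᶠ p in levelsToZero, 0 < g p.1 p.2) {s : ℝ} (hs : 1 < s) :
    ∀ᶠ p in levelsToZero, f p.1 p.2 ≤ s * g p.1 p.2 := by
  filter_upwards [h.eventually_lt_const hs, hg] with p hp hgp
  exact ((div_lt_iff₀ hgp).1 hp).le

theorem sim_of_eventually_between {f g : ℝ → ℝ → ℝ≥0∞}
    (hg : ∀ᶠ p in levelsToZero, g p.1 p.2 ≠ 0 ∧ g p.1 p.2 ≠ ⊤)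
    (hlower : ∀ r ∈ Set.Ioo (0 : ℝ) 1,
      ∀ᶠ p in levelsToZero, ENNReal.ofReal r * g p.1 p.2 ≤ f p.1 p.2)
    (hupper : ∀ r > 1, ∀ᶠ p in levelsToZero, f p.1 p.2 ≤ ENNReal.ofReal r * g p.1 p.2) :
    Sim f g := by
  refine tendsto_order.2 ⟨fun x hx => ?_, fun x hx => ?_⟩
  · obtain ⟨r, -, hxr, hr⟩ := ENNReal.lt_iff_exists_real_btwn.1 hx
    have hr0 : 0 < r := ENNReal.ofReal_pos.1 (pos_of_gt hxr)
    filter_upwards [hlower r ⟨hr0, ENNReal.ofReal_lt_one.1 hr⟩, hg] with p hp ⟨hg0, hg1⟩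
    exact hxr.trans_le ((ENNReal.le_div_iff_mul_le (.inl hg0) (.inl hg1)).2 hp)
  · obtain ⟨r, -, hr, hrx⟩ := ENNReal.lt_iff_exists_real_btwn.1 hx
    filter_upwards [hupper r (ENNReal.one_lt_ofReal.1 hr), hg] with p hp ⟨hg0, hg1⟩
    exact ((ENNReal.div_le_iff hg0 hg1).2 hp).trans_lt hrx

theorem Sim.div {e f g : ℝ → ℝ → ℝ≥0∞} (he : Sim e g) (hf : Sim f g)
    (hg : ∀ᶠ p in levelsToZero, g p.1 p.2 ≠ 0 ∧ g p.1 p.2 ≠ ⊤) : Sim e f := by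
  have h := ENNReal.Tendsto.div he (.inl one_ne_zero) hf (.inl ENNReal.one_ne_top)
  rw [div_one] at h
  refine h.congr' (hg.mono fun p ⟨hg0, hg1⟩ => ?_)
  simp only [div_eq_mul_inv]
  rw [ENNReal.mul_inv (.inr (ENNReal.inv_ne_top.2 hg0)) (.inr (ENNReal.inv_ne_zero.2 hg1)), inv_inv,
    mul_mul_mul_comm, ENNReal.inv_mul_cancel hg0 hg1, mul_one]

theorem tendsto_abs_log_levelsToZero :
    Tendsto (fun p : ℝ × ℝ => |Real.log p.1|) levelsToZero atTop :=
  tendsto_abs_log_nhdsGT_zero.comp tendsto_fst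

end Asymptotics

section Optimality

variable {K : ℕ} {Ω : Type*} {m0 : MeasurableSpace Ω} {ℱ : Filtration ℕ m0}
  {P : Finset (Fin K) → Measure Ω} {Λ : ℕ → Ω → Fin K → ℝ} {I J : Fin K → ℝ}
  {A : Finset (Fin K)} {i : Fin K} {m : ℕ}

theorem HasLowerRates.eventually_lintegral_firstTime_le [IsProbabilityMeasure (P A)]
    (h : HasLowerRates P Λ I J) (hΛ : ∀ n, Measurable (Λ n)) (hi : i ∈ A) (hmK : m < K)
    (hR : 0 < separationRate I J m A i) {a c : ℝ → ℝ → ℝ} {τ : ℝ → ℝ → EReal}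
    (ha : RealSim a fun α _ => |Real.log α|) (hc : RealSim c fun α _ => |Real.log α|)
    (hτ : A.card ≠ m → ∀ α β, τ α β ≤ a α β) {r : ℝ} (hr : 1 < r) :
    ∀ᶠ p in levelsToZero,
      ∫⁻ ω, (firstTime fun n => StandsOut (τ p.1 p.2) (c p.1 p.2) m (Λ n ω) i : ℝ≥0∞) ∂P A ≤
        ENNReal.ofReal (r * (|Real.log p.1| / separationRate I J m A i)) := by
  set R := separationRate I J m A i
  obtain ⟨s, hs1, hsr⟩ := exists_between hr
  have hr0 : 0 < r := one_pos.trans hr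
  obtain ⟨ρ, hρ, hρR⟩ : ∃ ρ, s * R / r < ρ ∧ ρ < R :=
    exists_between ((div_lt_iff₀ hr0).2 (by nlinarith))
  have hρ0 : 0 < ρ := lt_trans (by positivity) hρ
  have hgap : 0 < r / R - s / ρ := by
    rw [sub_pos, div_lt_div_iff₀ hρ0 hR]
    rwa [div_lt_iff₀' hr0] at hρ
  obtain ⟨C, hC, hle⟩ := h.exists_lintegral_firstTime_le hΛ hi hmK hρ0 hρR
  have hlog := tendsto_abs_log_levelsToZero
  have hlog0 := hlog.eventually_gt_atTop 0
  filter_upwards [ha.eventually_le hlog0 hs1, hc.eventually_le hlog0 hs1, hlog0,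
    (hlog.const_mul_atTop hgap).eventually_ge_atTop C.toReal] with p hap hcp hp hCp
  calc _ ≤ ENNReal.ofReal (s * |Real.log p.1| / ρ) + C :=
        hle _ _ _ (by positivity)
          (fun hA => (hτ hA p.1 p.2).trans (EReal.coe_le_coe hap)) hcp
    _ = ENNReal.ofReal (s * |Real.log p.1| / ρ + C.toReal) := by
        rw [ENNReal.ofReal_add (by positivity) ENNReal.toReal_nonneg, ENNReal.ofReal_toReal hC]
    _ ≤ ENNReal.ofReal (r * (|Real.log p.1| / R)) := by
        gcongr
        linear_combination hCp

/-- The rule `StandsOut` attains, to first order, every lower bound `L` on its expected time which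
comes from testing `P A` against the alternatives without the signal `i`. -/
theorem IsLikelihoodModel.sim_of_minDecisionTime_le [∀ A, IsProbabilityMeasure (P A)]
    (hP : IsLikelihoodModel ℱ P Λ) (hupper : HasUpperRates P Λ I J)
    (hlower : HasLowerRates P Λ I J) (hI : ∀ k, 0 < I k) (hJ : ∀ k, 0 < J k) (hi : i ∈ A)
    (hm : m ≤ A.card) (hmK : m < K) {a c : ℝ → ℝ → ℝ} {τ : ℝ → ℝ → EReal}
    (ha : RealSim a fun α _ => |Real.log α|) (hc : RealSim c fun α _ => |Real.log α|)
    (hτ : A.card ≠ m → ∀ α β, τ α β ≤ a α β) {E L : ℝ → ℝ → ℝ≥0∞}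
    (hE : ∀ α β, E α β ≤
      ∫⁻ ω, (firstTime fun n => StandsOut (τ α β) (c α β) m (Λ n ω) i : ℝ≥0∞) ∂P A)
    (hLE : ∀ᶠ p in levelsToZero, L p.1 p.2 ≤ E p.1 p.2)
    (hL : ∀ B : Finset (Fin K), i ∉ B → m ≤ B.card → B.card ≤ A.card →
      ∀ α β, minDecisionTime ℱ (P A) (P B) α β ≤ L α β) :
    Sim E L ∧ Sim L fun α _ => ENNReal.ofReal |Real.log α| /
      (ENNReal.ofReal (I i) + minNoise J A * if A.card = m then 1 else 0) := by
  have hR : 0 < separationRate I J m A i := separationRate_pos hI hJ hmK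
  simp_rw [← ofReal_separationRate (i := i) (A := A) hI hJ hmK, ← ENNReal.ofReal_div_of_pos hR]
  set g : ℝ → ℝ → ℝ≥0∞ := fun α _ => ENNReal.ofReal (|Real.log α| / separationRate I J m A i)
  have hg : ∀ᶠ p : ℝ × ℝ in levelsToZero, g p.1 p.2 ≠ 0 ∧ g p.1 p.2 ≠ ⊤ := by
    filter_upwards [tendsto_abs_log_levelsToZero.eventually_gt_atTop 0] with p hp
    exact ⟨(ENNReal.ofReal_pos.2 (by positivity)).ne', ENNReal.ofReal_ne_top⟩
  obtain ⟨B, hiB, hmB, hBA, hgrowth⟩ := hupper.exists_alternative hi hm hmK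
  have hL_ge : ∀ r ∈ Set.Ioo (0 : ℝ) 1,
      ∀ᶠ p in levelsToZero, ENNReal.ofReal r * g p.1 p.2 ≤ L p.1 p.2 := fun r ⟨hr0, hr1⟩ => by
    filter_upwards [(hP B A).eventually_le_minDecisionTime hgrowth hR hr0 hr1] with p hp
    rw [← ENNReal.ofReal_mul hr0.le]
    exact hp.trans (hL B hiB hmB hBA p.1 p.2)
  have hE_le : ∀ r > 1, ∀ᶠ p in levelsToZero, E p.1 p.2 ≤ ENNReal.ofReal r * g p.1 p.2 :=
    fun r hr => by
      filter_upwards [hlower.eventually_lintegral_firstTime_le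
        (fun n => (hP.measurable n).mono (ℱ.le n) le_rfl) hi hmK hR ha hc hτ hr] with p hp
      rw [← ENNReal.ofReal_mul (by linarith)]
      exact (hE p.1 p.2).trans hp
  have hEg : Sim E g := sim_of_eventually_between hg
    (fun r hr => (hL_ge r hr).mp (hLE.mono fun _ h h' => h'.trans h)) hE_le
  have hLg : Sim L g := sim_of_eventually_between hg hL_ge
    fun r hr => (hE_le r hr).mp (hLE.mono fun _ h h' => h.trans h')
  exact ⟨hEg.div hLg hg, hLg⟩

end Optimality

section ProductDensity

variable {ι : Type*} [Fintype ι] {X : ι → Type*} {f : ∀ i, X i → ℝ≥0∞}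

theorem setLIntegral_univ_pi_prod [∀ i, MeasurableSpace (X i)] {μ : ∀ i, Measure (X i)}
    [∀ i, IsProbabilityMeasure (μ i)] (hf : ∀ i, Measurable (f i)) {s : ∀ i, Set (X i)}
    (hs : ∀ i, MeasurableSet (s i)) :
    ∫⁻ x in Set.univ.pi s, ∏ i, f i (x i) ∂Measure.pi μ = ∏ i, ∫⁻ y in s i, f i y ∂μ i := by
  have hind : (Set.univ.pi s).indicator (fun x => ∏ i, f i (x i)) =
      fun x => ∏ i, (s i).indicator (f i) (x i) := by
    funext x
    classical
    simp [Set.indicator_apply, Finset.prod_ite_zero]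
  have hm (i : ι) : Measurable ((s i).indicator (f i)) := (hf i).indicator (hs i)
  rw [← lintegral_indicator (.univ_pi hs), hind,
    ProbabilityTheory.lintegral_prod_eq_prod_lintegral_of_indepFun Finset.univ
      (fun i (x : ∀ i, X i) => (s i).indicator (f i) (x i))
      (ProbabilityTheory.iIndepFun_pi fun i => (hm i).aemeasurable)
      fun i => (hm i).comp (measurable_pi_apply i)]
  exact Finset.prod_congr rfl fun i _ => by
    rw [(measurePreserving_eval μ i).lintegral_comp (hm i), lintegral_indicator (hs i)]

theorem pi_apply_eq_setLIntegral_prod {m m0 : ∀ i, MeasurableSpace (X i)} (hm : ∀ i, m i ≤ m0 i)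
    {μ ν : ∀ i, Measure (X i)} [∀ i, IsProbabilityMeasure (μ i)] [∀ i, IsProbabilityMeasure (ν i)]
    (hf : ∀ i, Measurable (f i))
    (hν : ∀ i s, MeasurableSet[m i] s → ν i s = ∫⁻ x in s, f i x ∂μ i) {E : Set (∀ i, X i)}
    (hE : MeasurableSet[⨆ i, (m i).comap fun x => x i] E) :
    Measure.pi ν E = ∫⁻ x in E, ∏ i, f i (x i) ∂Measure.pi μ := by
  have hle : ⨆ i, (m i).comap (fun x : ∀ i, X i => x i) ≤ MeasurableSpace.pi :=
    iSup_mono fun i => MeasurableSpace.comap_mono (hm i)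
  have hrect (s : ∀ i, Set (X i)) (hs : ∀ i, MeasurableSet[m i] (s i)) :
      Measure.pi ν (Set.univ.pi s) =
        (Measure.pi μ).withDensity (fun x => ∏ i, f i (x i)) (Set.univ.pi s) := by
    have hs' (i : ι) : MeasurableSet (s i) := hm i _ (hs i)
    rw [withDensity_apply _ (.univ_pi hs'), setLIntegral_univ_pi_prod hf hs', Measure.pi_pi]
    exact Finset.prod_congr rfl fun i _ => hν i _ (hs i)
  rw [← withDensity_apply _ (hle _ hE)]
  refine ext_on_measurableSpace_of_generate_finite _ _ ?_ hle
    (@generateFrom_pi _ _ _ m).symm (@isPiSystem_pi _ _ m) ?_ hE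
  · rintro _ ⟨s, hs, rfl⟩
    exact hrect s fun i => hs i (Set.mem_univ i)
  · rw [← Set.pi_univ Set.univ]
    exact hrect _ fun i => @MeasurableSet.univ _ (m i)

end ProductDensity

theorem apply_eq_setLIntegral_exp {Ω : Type*} {m m0 : MeasurableSpace Ω} (hm : m ≤ m0)
    {P Q : Measure Ω} [IsFiniteMeasure P] [IsFiniteMeasure Q] (hQP : Q.trim hm ≪ P.trim hm)
    {L : Ω → ℝ} (hLm : Measurable[m] L) (hL : ∀ᵐ ω ∂P.trim hm,
      Real.exp (L ω) = ((Q.trim hm).rnDeriv (P.trim hm) ω).toReal)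
    {E : Set Ω} (hE : MeasurableSet[m] E) :
    Q E = ∫⁻ ω in E, ENNReal.ofReal (Real.exp (L ω)) ∂P := by
  have hm' : Measurable[m] fun ω => ENNReal.ofReal (Real.exp (L ω)) := hLm.exp.ennreal_ofReal
  rw [← setLIntegral_trim hm hm' hE, ← trim_measurableSet_eq hm hE,
    ← Measure.setLIntegral_rnDeriv hQP]
  refine setLIntegral_congr_fun_ae hE ?_
  filter_upwards [hL, Measure.rnDeriv_lt_top (Q.trim hm) (P.trim hm)] with ω hω hω' _
  rw [hω, ENNReal.ofReal_toReal hω'.ne]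

section JointLaw

variable {K : ℕ} {S : Fin K → Type*} [∀ k, MeasurableSpace (S k)]
  {P0 P1 : ∀ k, Measure (ℕ → S k)}
  {I J : Fin K → ℝ} {A : Finset (Fin K)} {k : Fin K}

theorem measurable_streamLLR {S : Type*} [MeasurableSpace S] (P0 P1 : Measure (ℕ → S)) (n : ℕ) :
    Measurable[streamFiltration S n] (streamLLR P0 P1 n) :=
  measurable_llr _ _

theorem measurable_lam (P0 P1 : ∀ k, Measure (ℕ → S k)) (n : ℕ) (k : Fin K) :
    Measurable[globalFiltration S n] fun ω => lam P0 P1 n ω k :=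
  (measurable_streamLLR (P0 k) (P1 k) n).comp <| measurable_iff_comap_le.2 <|
    le_iSup (fun k => MeasurableSpace.comap (fun ω : ∀ k, ℕ → S k => ω k)
      (streamFiltration (S k) n)) k

variable [∀ k, IsProbabilityMeasure (P0 k)] [∀ k, IsProbabilityMeasure (P1 k)]

instance isProbabilityMeasure_ite (A : Finset (Fin K)) (k : Fin K) :
    IsProbabilityMeasure (if k ∈ A then P1 k else P0 k) := by
  split_ifs <;> infer_instance

instance isProbabilityMeasure_jointLaw (A : Finset (Fin K)) :
    IsProbabilityMeasure (jointLaw P0 P1 A) := by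
  unfold jointLaw
  infer_instance

theorem measurePreserving_jointLaw_of_mem (hk : k ∈ A) :
    MeasurePreserving (fun ω : ∀ k, ℕ → S k => ω k) (jointLaw P0 P1 A) (P1 k) := by
  have h := measurePreserving_eval (fun k => if k ∈ A then P1 k else P0 k) k
  rwa [if_pos hk] at h

theorem measurePreserving_jointLaw_of_notMem (hk : k ∉ A) :
    MeasurePreserving (fun ω : ∀ k, ℕ → S k => ω k) (jointLaw P0 P1 A) (P0 k) := by
  have h := measurePreserving_eval (fun k => if k ∈ A then P1 k else P0 k) k
  rwa [if_neg hk] at h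

theorem isLikelihoodModel_jointLaw (h : ∀ k, LocallyEquivalent (P0 k) (P1 k)) :
    IsLikelihoodModel (globalFiltration S) (jointLaw P0 P1) (lam P0 P1) := by
  refine fun A B => ⟨fun n => (Finset.measurable_sum _ fun k _ => measurable_lam P0 P1 n k).sub
    (Finset.measurable_sum _ fun k _ => measurable_lam P0 P1 n k), fun n E hE => ?_⟩
  have hle (k : Fin K) := (streamFiltration (S k)).le n
  have hmeas (k : Fin K) := measurable_streamLLR (P0 k) (P1 k) n
  set w : Fin K → ℝ := fun k => (if k ∈ B then 1 else 0) - (if k ∈ A then 1 else 0) with hw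
  set f : ∀ k, (ℕ → S k) → ℝ≥0∞ := fun k x =>
    ENNReal.ofReal (Real.exp (w k * streamLLR (P0 k) (P1 k) n x)) with hf
  have hfm (k : Fin K) : Measurable (f k) :=
    (Real.measurable_exp.comp (((hmeas k).mono (hle k) le_rfl).const_mul _)).ennreal_ofReal
  have hprod (ω : ∀ k, ℕ → S k) : ENNReal.ofReal (Real.exp
      (∑ k ∈ B, lam P0 P1 n ω k - ∑ k ∈ A, lam P0 P1 n ω k)) = ∏ k, f k (ω k) := by
    have hsum : ∑ k ∈ B, lam P0 P1 n ω k - ∑ k ∈ A, lam P0 P1 n ω k =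
        ∑ k, w k * lam P0 P1 n ω k := by
      simp [hw, sub_mul, Finset.sum_sub_distrib]
    rw [hsum, Real.exp_sum, ENNReal.ofReal_prod_of_nonneg fun _ _ => (Real.exp_pos _).le]
    rfl
  simp_rw [hprod]
  refine pi_apply_eq_setLIntegral_prod hle hfm
    (fun k s hs => ?_) hE
  by_cases hB : k ∈ B <;> by_cases hA : k ∈ A
  · simp [hf, hw, hA, hB]
  · simpa [hf, hw, hA, hB] using apply_eq_setLIntegral_exp (hle k) (h k n).1 (hmeas k)
      (exp_llr_of_ac' _ _ (h k n).2) hs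
  · simpa [hf, hw, hA, hB] using apply_eq_setLIntegral_exp (hle k) (h k n).2 (hmeas k).neg
      (exp_neg_llr (h k n).1) hs
  · simp [hf, hw, hA, hB]

theorem eventually_le_mul_of_limsup_le {f : ℕ → ℝ} {R r : ℝ} (hr : R < r)
    (h : limsup (fun n : ℕ => ((f n / n : ℝ) : EReal)) atTop ≤ (R : EReal)) :
    ∀ᶠ n : ℕ in atTop, f n ≤ r * n := by
  filter_upwards [eventually_lt_of_limsup_lt (h.trans_lt (EReal.coe_lt_coe_iff.2 hr)),
    eventually_gt_atTop 0] with n hn hn0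
  exact ((div_lt_iff₀ (by positivity)).1 (EReal.coe_lt_coe_iff.1 hn)).le

theorem hasUpperRates_jointLaw (h : ∀ k, LimsupCondition (P0 k) (P1 k) (I k) (J k)) :
    HasUpperRates (jointLaw P0 P1) (lam P0 P1) I J where
  signal _ k hk _ hr :=
    ((measurePreserving_jointLaw_of_mem hk).quasiMeasurePreserving.ae (h k).1).mono
      fun _ => eventually_le_mul_of_limsup_le hr
  noise _ k hk _ hr :=
    ((measurePreserving_jointLaw_of_notMem hk).quasiMeasurePreserving.ae (h k).2).mono
      fun _ => eventually_le_mul_of_limsup_le hr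

theorem hasLowerRates_jointLaw (h : ∀ k, CompleteConvergence (P0 k) (P1 k) (I k) (J k)) :
    HasLowerRates (jointLaw P0 P1) (lam P0 P1) I J := by
  have hm (k : Fin K) (n : ℕ) : Measurable (streamLLR (P0 k) (P1 k) n) :=
    (measurable_streamLLR (P0 k) (P1 k) n).mono ((streamFiltration (S k)).le n) le_rfl
  refine ⟨fun A k hk ε hε => ?_, fun A k hk ε hε => ?_⟩
  · refine (tsum_congr fun n => ?_).trans_lt (h k ε hε).1
    exact (measurePreserving_jointLaw_of_mem hk).measure_preimage
      (measurableSet_le ((hm k _).div_const _) measurable_const).nullMeasurableSet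
  · refine (tsum_congr fun n => ?_).trans_lt (h k ε hε).2
    exact (measurePreserving_jointLaw_of_notMem hk).measure_preimage
      (measurableSet_le ((hm k _).neg.div_const _) measurable_const).nullMeasurableSet

end JointLaw

section Procedures

variable {K : ℕ} {S : Fin K → Type*} [∀ k, MeasurableSpace (S k)]
  {P0 P1 : ∀ k, Measure (ℕ → S k)} {α β : ℝ} {Pi : Set (Finset (Fin K))} {χ : Procedure S}
  {A B : Finset (Fin K)} {i j : Fin K}

theorem isSequential_of_isStoppingTime {τ σ : Fin K → (∀ k, ℕ → S k) → ℕ∞}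
    (hτ : ∀ k, IsStoppingTime (globalFiltration S) (τ k))
    (hσ : ∀ k, IsStoppingTime (globalFiltration S) (σ k)) (hτ1 : ∀ k ω, 1 ≤ τ k ω)
    (hσ1 : ∀ k ω, 1 ≤ σ k ω) :
    Procedure.IsSequential
      ⟨fun k ω => min (τ k ω) (σ k ω), fun ω => {k | min (τ k ω) (σ k ω) = τ k ω}⟩ where
  one_le k ω := le_min (hτ1 k ω) (hσ1 k ω)
  stopping k n := ((hτ k).min (hσ k)).measurableSet_eq n
  signal k n := by
    convert ((hτ k).measurableSet_eq n).inter ((hσ k).measurableSet_ge n) using 1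
    ext ω
    simp only [Set.mem_ofPred_eq, min_eq_left_iff, Set.mem_inter_iff]
    exact ⟨fun ⟨h, hle⟩ => by rw [min_eq_left hle] at h; exact ⟨h, h.ge.trans hle⟩,
      fun ⟨h, hle⟩ => ⟨(min_eq_left (h.trans_le hle)).trans h, h.trans_le hle⟩⟩
  noise k n := by
    convert ((hσ k).measurableSet_eq n).inter ((hτ k).measurableSet_gt n) using 1
    ext ω
    simp only [Set.mem_ofPred_eq, min_eq_left_iff, not_le, Set.mem_inter_iff]
    exact ⟨fun ⟨h, hlt⟩ => by rw [min_eq_right hlt.le] at h; exact ⟨h, h.ge.trans_lt hlt⟩,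
      fun ⟨h, hlt⟩ => ⟨(min_eq_right (h.trans_lt hlt).le).trans h, h.trans_lt hlt⟩⟩

theorem Procedure.IsSequential.measurable (h : χ.IsSequential) (k : Fin K) :
    Measurable (χ.T k) :=
  ENat.measurable_iff.2 fun n => (globalFiltration S).le n _ (h.stopping k n)

theorem minDecisionTime_le_optimalTime_of_mem (hA : A ∈ Pi) (hB : B ∈ Pi) (hiA : i ∈ A)
    (hiB : i ∉ B) :
    minDecisionTime (globalFiltration S) (jointLaw P0 P1 A) (jointLaw P0 P1 B) α β ≤
      optimalTime P0 P1 i A α β Pi := by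
  refine le_iInf₂ fun χ ⟨hχ, herr⟩ => iInf_le_of_le (χ.T i) <| iInf₂_le {ω | i ∈ χ.D ω}
    ⟨hχ.measurable i, hχ.signal i, ?_, ?_⟩
  · exact (herr B hB).2.1.trans' (measure_mono fun ω hω => ⟨i, hω, hiB⟩)
  · exact (herr A hA).2.2.trans' (measure_mono fun ω hω => ⟨i, hiA, hω⟩)

theorem minDecisionTime_le_optimalTime_of_notMem (hA : A ∈ Pi) (hB : B ∈ Pi) (hjA : j ∉ A)
    (hjB : j ∈ B) :
    minDecisionTime (globalFiltration S) (jointLaw P0 P1 A) (jointLaw P0 P1 B) β α ≤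
      optimalTime P0 P1 j A α β Pi := by
  refine le_iInf₂ fun χ ⟨hχ, herr⟩ => iInf_le_of_le (χ.T j) <| iInf₂_le {ω | j ∉ χ.D ω}
    ⟨hχ.measurable j, hχ.noise j, ?_, ?_⟩
  · exact (herr B hB).2.2.trans' (measure_mono fun ω hω => ⟨j, hjB, hω⟩)
  · exact (herr A hA).2.1.trans' (measure_mono fun ω hω => ⟨j, not_not.1 hω, hjA⟩)

theorem eventually_optimalTime_le_expectedTime {χ : ℝ → ℝ → Procedure S}
    (hχ : ∀ α ∈ Set.Ioo (0 : ℝ) 1, ∀ β ∈ Set.Ioo (0 : ℝ) 1,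
      χ α β ∈ errorClass P0 P1 α β Pi) (k : Fin K) (A : Finset (Fin K)) :
    ∀ᶠ p in levelsToZero,
      optimalTime P0 P1 k A p.1 p.2 Pi ≤ expectedTime P0 P1 (χ p.1 p.2) k A := by
  have hIoo : Set.Ioo (0 : ℝ) 1 ∈ 𝓝[>] 0 := Ioo_mem_nhdsGT one_pos
  filter_upwards [prod_mem_prod hIoo hIoo] with p hp
  exact iInf₂_le _ (hχ p.1 hp.1 p.2 hp.2)

end Procedures

section Proposed

variable {K : ℕ} {S : Fin K → Type*} [∀ k, MeasurableSpace (S k)]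
  {P0 P1 : ∀ k, Measure (ℕ → S k)} {I J : Fin K → ℝ} {A : Finset (Fin K)} {i j k : Fin K}
  {l u : ℕ} {a b c d α β : ℝ}

/-- The threshold of the proposed procedure for a single log-likelihood ratio. There is none if the
number of signals is known, which is encoded by `⊤`. -/
noncomputable def absoluteThreshold (l u : ℕ) (a : ℝ) : EReal := if l = u then ⊤ else a

theorem absoluteThreshold_of_ne (h : l ≠ u) (a : ℝ) : absoluteThreshold l u a = a := if_neg h

theorem signalTime_eq_firstTime (P0 P1 : ∀ k, Measure (ℕ → S k)) (l u : ℕ) (a c : ℝ)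
    (k : Fin K) : signalTime P0 P1 l u a c k = fun ω =>
      firstTime fun n => StandsOut (absoluteThreshold l u a) c l (lam P0 P1 n ω) k := by
  funext ω
  rw [signalTime]
  split_ifs with h <;> simp [StandsOut, absoluteThreshold, h]

theorem noiseTime_eq_firstTime (P0 P1 : ∀ k, Measure (ℕ → S k)) (hu : 0 < u) (huK : u ≤ K)
    (b d : ℝ) (k : Fin K) : noiseTime P0 P1 l u b d k = fun ω =>
      firstTime fun n => StandsOut (absoluteThreshold l u b) d (K - u) ((-lam P0 P1) n ω) k := by
  have hgap (v : Fin K → ℝ) : kthLargest (-v) (K - u + 1) + d ≤ (-v) k ↔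
      v k ≤ kthLargest v u - d := by
    rw [kthLargest_neg v hu huK, Pi.neg_apply]
    constructor <;> intro h <;> linarith
  funext ω
  rw [noiseTime]
  split_ifs with h
  · simp [StandsOut, absoluteThreshold, h, ← hgap]
  · simp [StandsOut, absoluteThreshold, h, ← hgap, -EReal.coe_neg, le_neg (a := b)]

theorem isSequential_proposed (P0 P1 : ∀ k, Measure (ℕ → S k)) (hu : 0 < u) (huK : u ≤ K) :
    (proposed P0 P1 l u a b c d).IsSequential := by
  have hlam (n : ℕ) : Measurable[globalFiltration S n] (lam P0 P1 n) :=
    @measurable_pi_lambda _ _ _ (globalFiltration S n) _ _ fun k => measurable_lam P0 P1 n k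
  refine isSequential_of_isStoppingTime (fun k => ?_) (fun k => ?_) (fun k ω => ?_) fun k ω => ?_
  · rw [signalTime_eq_firstTime]
    exact isStoppingTime_firstTime fun n => hlam n (measurableSet_standsOut _ _ _ _)
  · rw [noiseTime_eq_firstTime P0 P1 hu huK]
    exact isStoppingTime_firstTime fun n => (hlam n).neg (measurableSet_standsOut _ _ _ _)
  · rw [signalTime_eq_firstTime]
    exact one_le_firstTime _
  · rw [noiseTime_eq_firstTime P0 P1 hu huK]
    exact one_le_firstTime _

variable [∀ k, IsProbabilityMeasure (P0 k)] [∀ k, IsProbabilityMeasure (P1 k)]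

theorem ae_proposed_T_lt_top (hequiv : ∀ k, LocallyEquivalent (P0 k) (P1 k))
    (hcomplete : ∀ k, CompleteConvergence (P0 k) (P1 k) (I k) (J k)) (hI : ∀ k, 0 < I k)
    (hJ : ∀ k, 0 < J k) (hu : 0 < u) (huK : u ≤ K) (hl : l < K)
    (hA : A ∈ boundedClass K l u) (k : Fin K) :
    ∀ᵐ ω ∂jointLaw P0 P1 A, (proposed P0 P1 l u a b c d).T k ω < ⊤ := by
  have hmodel := isLikelihoodModel_jointLaw hequiv
  have hrates := hasLowerRates_jointLaw hcomplete
  have htop (x : ℝ) (h : l ≠ u) : absoluteThreshold l u x < ⊤ :=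
    absoluteThreshold_of_ne h x ▸ EReal.coe_lt_top x
  have hcard := Finset.card_add_card_compl A
  obtain ⟨hlA, hAu⟩ := hA
  rw [Fintype.card_fin] at hcard
  by_cases hk : k ∈ A
  · have hfin := ae_firstTime_standsOut_lt_top hmodel hrates hI hJ hk hl
      (fun h => htop a (by omega)) c
    exact hfin.mono fun ω hω => min_lt_of_left_lt (by rwa [signalTime_eq_firstTime])
  · have hfin := ae_firstTime_standsOut_lt_top hmodel.dual hrates.dual hJ hI
      (Finset.mem_compl.2 hk) (by omega : K - u < K) (fun h => htop b (by omega)) d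
    rw [compl_compl] at hfin
    exact hfin.mono fun ω hω => min_lt_of_right_lt (by rwa [noiseTime_eq_firstTime P0 P1 hu huK])

theorem FWE1_proposed_le (hequiv : ∀ k, LocallyEquivalent (P0 k) (P1 k))
    (hlA : l ≤ A.card) (hc : 0 < c)
    (hT : ∀ k, ∀ᵐ ω ∂jointLaw P0 P1 A, (proposed P0 P1 l u a b c d).T k ω < ⊤) :
    FWE1 P0 P1 (proposed P0 P1 l u a b c d) A ≤ Aᶜ.card *
      (EReal.exp (-absoluteThreshold l u a) + A.card * ENNReal.ofReal (Real.exp (-c))) := by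
  refine (measure_mono_ae ?_).trans <|
    (isLikelihoodModel_jointLaw hequiv).measure_exists_notMem_standsOut_le hlA hc
  filter_upwards [ae_all_iff.2 hT] with ω hω ⟨k, hkD, hkA⟩
  have hsignal : signalTime P0 P1 l u a c k ω < ⊤ := (Eq.symm hkD).trans_lt (hω k)
  rw [signalTime_eq_firstTime] at hsignal
  exact ⟨k, hkA, exists_of_firstTime_ne_top hsignal.ne⟩

theorem FWE2_proposed_le (hequiv : ∀ k, LocallyEquivalent (P0 k) (P1 k))
    (hu : 0 < u) (huK : u ≤ K) (hAu : A.card ≤ u) (hd : 0 < d) :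
    FWE2 P0 P1 (proposed P0 P1 l u a b c d) A ≤ A.card *
      (EReal.exp (-absoluteThreshold l u b) + Aᶜ.card * ENNReal.ofReal (Real.exp (-d))) := by
  have hcard : K - u ≤ Aᶜ.card := by
    rw [Finset.card_compl, Fintype.card_fin]
    omega
  have hle := (isLikelihoodModel_jointLaw hequiv).dual.measure_exists_notMem_standsOut_le hcard
    (a := absoluteThreshold l u b) hd
  rw [compl_compl] at hle
  refine (measure_mono ?_).trans hle
  rintro ω ⟨k, hkA, hkD⟩
  have hnoise : noiseTime P0 P1 l u b d k ω < signalTime P0 P1 l u a c k ω :=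
    not_le.1 fun h => hkD (min_eq_left h)
  rw [noiseTime_eq_firstTime P0 P1 hu huK] at hnoise
  exact ⟨k, by simpa using hkA, exists_of_firstTime_ne_top hnoise.ne_top⟩

theorem proposed_mem_errorClass (hequiv : ∀ k, LocallyEquivalent (P0 k) (P1 k))
    (hcomplete : ∀ k, CompleteConvergence (P0 k) (P1 k) (I k) (J k)) (hI : ∀ k, 0 < I k)
    (hJ : ∀ k, 0 < J k) (hu : 0 < u) (huK : u ≤ K) (hl : l < K) (hc : 0 < c) (hd : 0 < d)
    (hα : ∀ A ∈ boundedClass K l u, Aᶜ.card * (EReal.exp (-absoluteThreshold l u a) +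
      A.card * ENNReal.ofReal (Real.exp (-c))) ≤ ENNReal.ofReal α)
    (hβ : ∀ A ∈ boundedClass K l u, A.card * (EReal.exp (-absoluteThreshold l u b) +
      Aᶜ.card * ENNReal.ofReal (Real.exp (-d))) ≤ ENNReal.ofReal β) :
    proposed P0 P1 l u a b c d ∈ errorClass P0 P1 α β (boundedClass K l u) := by
  refine ⟨isSequential_proposed P0 P1 hu huK, fun A hA => ?_⟩
  have hT := ae_proposed_T_lt_top (a := a) (b := b) (c := c) (d := d) hequiv hcomplete hI hJ hu huK
    hl hA
  exact ⟨hT, (FWE1_proposed_le hequiv hA.1 hc hT).trans (hα A hA),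
    (FWE2_proposed_le hequiv hu huK hA.2 hd).trans (hβ A hA)⟩

end Proposed

section Thresholds

variable {α β x : ℝ} {p q : ℕ}

theorem abs_log_add_log_pos (hα : α ∈ Set.Ioo (0 : ℝ) 1) (hx : 1 ≤ x) :
    0 < |Real.log α| + Real.log x :=
  add_pos_of_pos_of_nonneg (abs_pos.2 (Real.log_neg hα.1 hα.2).ne) (Real.log_nonneg hx)

theorem exp_neg_abs_log_add_log (hα : α ∈ Set.Ioo (0 : ℝ) 1) (hx : 0 < x) :
    Real.exp (-(|Real.log α| + Real.log x)) = α / x := by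
  rw [abs_of_neg (Real.log_neg hα.1 hα.2), neg_add, neg_neg, Real.exp_add, Real.exp_neg,
    Real.exp_log hα.1, Real.exp_log hx, div_eq_mul_inv]

theorem mul_exp_neg_threshold_le (hα : α ∈ Set.Ioo (0 : ℝ) 1) (hx : 0 < x)
    (hpq : p * q ≤ x) :
    (p : ℝ≥0∞) * (EReal.exp (-⊤) +
      q * ENNReal.ofReal (Real.exp (-(|Real.log α| + Real.log x)))) ≤ ENNReal.ofReal α := by
  rw [EReal.neg_top, EReal.exp_bot, zero_add, exp_neg_abs_log_add_log hα hx, ← mul_assoc,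
    ← ENNReal.ofReal_natCast p, ← ENNReal.ofReal_natCast q, ← ENNReal.ofReal_mul p.cast_nonneg,
    ← ENNReal.ofReal_mul (by positivity)]
  refine ENNReal.ofReal_le_ofReal ?_
  rw [mul_div_assoc', div_le_iff₀ hx, mul_comm α]
  exact mul_le_mul_of_nonneg_right hpq hα.1.le

theorem mul_exp_neg_thresholds_le {K : ℕ} (hα : α ∈ Set.Ioo (0 : ℝ) 1) (hpq : p + q = K)
    (hK : 0 < K) (hx : 0 < x) (hpx : p ≤ x) :
    (p : ℝ≥0∞) * (EReal.exp (-((|Real.log α| + Real.log K : ℝ) : EReal)) +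
      q * ENNReal.ofReal (Real.exp (-(|Real.log α| + Real.log (x * K))))) ≤
        ENNReal.ofReal α := by
  have hK' : (0 : ℝ) < K := Nat.cast_pos.2 hK
  have hα0 := hα.1
  rw [← EReal.coe_neg, EReal.exp_coe, exp_neg_abs_log_add_log hα hK',
    exp_neg_abs_log_add_log hα (mul_pos hx hK'), ← ENNReal.ofReal_natCast p,
    ← ENNReal.ofReal_natCast q, ← ENNReal.ofReal_mul q.cast_nonneg,
    ← ENNReal.ofReal_add (by positivity) (by positivity), ← ENNReal.ofReal_mul p.cast_nonneg]
  refine ENNReal.ofReal_le_ofReal ?_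
  have hpx' : p * (x + q) ≤ x * K := by
    rw [← hpq, Nat.cast_add, mul_add, mul_add, mul_comm x (p : ℝ)]
    gcongr
  calc p * (α / K + q * (α / (x * K))) = α * (p * (x + q) / (x * K)) := by field_simp
    _ ≤ α := mul_le_of_le_one_right hα0.le (div_le_one_of_le₀ hpx' (by positivity))

end Thresholds

section ProposedThresholds

variable {K : ℕ} {S : Fin K → Type*} [∀ k, MeasurableSpace (S k)]
  {P0 P1 : ∀ k, Measure (ℕ → S k)} {I J : Fin K → ℝ} {A : Finset (Fin K)} {i j : Fin K}
  {l m u : ℕ} {α β : ℝ}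
  [∀ k, IsProbabilityMeasure (P0 k)] [∀ k, IsProbabilityMeasure (P1 k)]

theorem proposed_mem_errorClass_of_card_eq (hequiv : ∀ k, LocallyEquivalent (P0 k) (P1 k))
    (hcomplete : ∀ k, CompleteConvergence (P0 k) (P1 k) (I k) (J k)) (hI : ∀ k, 0 < I k)
    (hJ : ∀ k, 0 < J k) (hm : 0 < m) (hmK : m < K) (hα : α ∈ Set.Ioo (0 : ℝ) 1)
    (hβ : β ∈ Set.Ioo (0 : ℝ) 1) (a b : ℝ) :
    proposed P0 P1 m m a b (|Real.log α| + Real.log ((m : ℝ) * ((K : ℝ) - m)))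
        (|Real.log β| + Real.log ((m : ℝ) * ((K : ℝ) - m))) ∈
      errorClass P0 P1 α β (boundedClass K m m) := by
  have hx : 1 ≤ (m : ℝ) * ((K : ℝ) - m) := by
    rw [← Nat.cast_sub hmK.le, ← Nat.cast_mul, Nat.one_le_cast]
    exact Nat.mul_pos hm (Nat.sub_pos_of_lt hmK)
  have hcard {A : Finset (Fin K)} (hA : A ∈ boundedClass K m m) :
      (A.card : ℝ) * Aᶜ.card = m * (K - m) := by
    rw [Finset.card_compl, Fintype.card_fin, ← le_antisymm hA.1 hA.2, Nat.cast_sub hmK.le]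
  have htop (x : ℝ) : absoluteThreshold m m x = ⊤ := if_pos rfl
  refine proposed_mem_errorClass hequiv hcomplete hI hJ hm hmK.le hmK (abs_log_add_log_pos hα hx)
    (abs_log_add_log_pos hβ hx) (fun A hA => htop a ▸ ?_) fun A hA => htop b ▸ ?_
  · exact mul_exp_neg_threshold_le hα (by linarith) (by rw [mul_comm, hcard hA])
  · exact mul_exp_neg_threshold_le hβ (by linarith) (hcard hA).le

theorem proposed_mem_errorClass_of_card_lt (hequiv : ∀ k, LocallyEquivalent (P0 k) (P1 k))
    (hcomplete : ∀ k, CompleteConvergence (P0 k) (P1 k) (I k) (J k)) (hI : ∀ k, 0 < I k)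
    (hJ : ∀ k, 0 < J k) (hlu : l < u) (huK : u ≤ K) (hα : α ∈ Set.Ioo (0 : ℝ) 1)
    (hβ : β ∈ Set.Ioo (0 : ℝ) 1) :
    proposed P0 P1 l u (|Real.log α| + Real.log K) (|Real.log β| + Real.log K)
        (|Real.log α| + Real.log (((K : ℝ) - l) * K)) (|Real.log β| + Real.log ((u : ℝ) * K)) ∈
      errorClass P0 P1 α β (boundedClass K l u) := by
  have hl : l < K := hlu.trans_le huK
  have hK : 0 < K := hl.pos
  have hu : 0 < u := hlu.pos
  have hx : 1 ≤ (K : ℝ) - l := by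
    rw [← Nat.cast_sub hl.le, Nat.one_le_cast]
    exact Nat.sub_pos_of_lt hl
  have hcard (A : Finset (Fin K)) : A.card + Aᶜ.card = K := by
    rw [Finset.card_add_card_compl, Fintype.card_fin]
  refine proposed_mem_errorClass hequiv hcomplete hI hJ hu huK hl
    (abs_log_add_log_pos hα (one_le_mul_of_one_le_of_one_le hx (Nat.one_le_cast.2 hK)))
    (abs_log_add_log_pos hβ (one_le_mul_of_one_le_of_one_le (Nat.one_le_cast.2 hu)
      (Nat.one_le_cast.2 hK)))
    (fun A hA => ?_) fun A hA => ?_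
  · rw [absoluteThreshold_of_ne hlu.ne]
    refine mul_exp_neg_thresholds_le hα (by rw [add_comm, hcard]) hK (by linarith) ?_
    rw [Finset.card_compl, Fintype.card_fin, ← Nat.cast_sub hl.le]
    exact Nat.cast_le.2 (Nat.sub_le_sub_left hA.1 K)
  · rw [absoluteThreshold_of_ne hlu.ne]
    exact mul_exp_neg_thresholds_le hβ (hcard A) hK (Nat.cast_pos.2 hu) (Nat.cast_le.2 hA.2)

variable {a b c d : ℝ → ℝ → ℝ}

theorem sim_expectedTime_proposed_of_mem (hequiv : ∀ k, LocallyEquivalent (P0 k) (P1 k))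
    (hlimsup : ∀ k, LimsupCondition (P0 k) (P1 k) (I k) (J k))
    (hcomplete : ∀ k, CompleteConvergence (P0 k) (P1 k) (I k) (J k)) (hI : ∀ k, 0 < I k)
    (hJ : ∀ k, 0 < J k) (hl : l < K)
    (hχ : ∀ α ∈ Set.Ioo (0 : ℝ) 1, ∀ β ∈ Set.Ioo (0 : ℝ) 1,
      proposed P0 P1 l u (a α β) (b α β) (c α β) (d α β) ∈
        errorClass P0 P1 α β (boundedClass K l u))
    (ha : RealSim a fun α _ => |Real.log α|) (hc : RealSim c fun α _ => |Real.log α|)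
    (hA : A ∈ boundedClass K l u) (hi : i ∈ A) :
    Sim (fun α β => expectedTime P0 P1
          (proposed P0 P1 l u (a α β) (b α β) (c α β) (d α β)) i A)
        (fun α β => optimalTime P0 P1 i A α β (boundedClass K l u)) ∧
      Sim (fun α β => optimalTime P0 P1 i A α β (boundedClass K l u))
        (fun α _ => ENNReal.ofReal |Real.log α| /
          (ENNReal.ofReal (I i) + minNoise J A * if A.card = l then 1 else 0)) := by
  have hne (h : A.card ≠ l) : l ≠ u := fun hlu => h (le_antisymm (hlu ▸ hA.2) hA.1)
  refine (isLikelihoodModel_jointLaw hequiv).sim_of_minDecisionTime_le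
    (hasUpperRates_jointLaw hlimsup) (hasLowerRates_jointLaw hcomplete) hI hJ hi hA.1 hl ha hc
    (τ := fun α β => absoluteThreshold l u (a α β))
    (fun h α β => (absoluteThreshold_of_ne (hne h) _).le) (fun α β => ?_)
    (eventually_optimalTime_le_expectedTime hχ i A) fun B hiB hlB hBA α β =>
      minDecisionTime_le_optimalTime_of_mem hA ⟨hlB, hBA.trans hA.2⟩ hi hiB
  refine lintegral_mono fun ω => ENat.toENNReal_le.2 <| (min_le_left _ _).trans_eq ?_
  rw [signalTime_eq_firstTime]

theorem sim_expectedTime_proposed_of_notMem (hequiv : ∀ k, LocallyEquivalent (P0 k) (P1 k))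
    (hlimsup : ∀ k, LimsupCondition (P0 k) (P1 k) (I k) (J k))
    (hcomplete : ∀ k, CompleteConvergence (P0 k) (P1 k) (I k) (J k)) (hI : ∀ k, 0 < I k)
    (hJ : ∀ k, 0 < J k) (hu : 0 < u) (huK : u ≤ K)
    (hχ : ∀ α ∈ Set.Ioo (0 : ℝ) 1, ∀ β ∈ Set.Ioo (0 : ℝ) 1,
      proposed P0 P1 l u (a α β) (b α β) (c α β) (d α β) ∈
        errorClass P0 P1 α β (boundedClass K l u))
    (hb : RealSim b fun _ β => |Real.log β|) (hd : RealSim d fun _ β => |Real.log β|)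
    (hA : A ∈ boundedClass K l u) (hj : j ∉ A) :
    Sim (fun α β => expectedTime P0 P1
          (proposed P0 P1 l u (a α β) (b α β) (c α β) (d α β)) j A)
        (fun α β => optimalTime P0 P1 j A α β (boundedClass K l u)) ∧
      Sim (fun α β => optimalTime P0 P1 j A α β (boundedClass K l u))
        (fun _ β => ENNReal.ofReal |Real.log β| /
          (ENNReal.ofReal (J j) + minSignal I A * if A.card = u then 1 else 0)) := by
  have hcard (B : Finset (Fin K)) : B.card + Bᶜ.card = K := by
    rw [Finset.card_add_card_compl, Fintype.card_fin]
  have hcardA := hcard A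
  obtain ⟨hlA, hAu⟩ := id hA
  have hne (h : Aᶜ.card ≠ K - u) : l ≠ u := by omega
  have hdual := (isLikelihoodModel_jointLaw hequiv).dual.sim_of_minDecisionTime_le
    (hasUpperRates_jointLaw hlimsup).dual (hasLowerRates_jointLaw hcomplete).dual hJ hI
    (Finset.mem_compl.2 hj) (by omega) (by omega : K - u < K) hb.swap hd.swap
    (τ := fun β α => absoluteThreshold l u (b α β))
    (E := fun β α => expectedTime P0 P1
      (proposed P0 P1 l u (a α β) (b α β) (c α β) (d α β)) j A)
    (L := fun β α => optimalTime P0 P1 j A α β (boundedClass K l u))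
    (fun h β α => (absoluteThreshold_of_ne (hne h) _).le) (fun β α => ?_)
    (tendsto_swap_levelsToZero.eventually (eventually_optimalTime_le_expectedTime hχ j A))
    fun B hjB huB hBA β α => ?_
  · have hrate : (ENNReal.ofReal (J j) + minNoise I Aᶜ * if Aᶜ.card = K - u then 1 else 0) =
        ENNReal.ofReal (J j) + minSignal I A * if A.card = u then 1 else 0 := by
      simp only [minNoise, minSignal, Finset.mem_compl, not_not,
        show Aᶜ.card = K - u ↔ A.card = u by omega]
    rw [hrate] at hdual
    exact ⟨hdual.1.swap, hdual.2.swap⟩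
  · rw [compl_compl]
    refine lintegral_mono fun ω => ENat.toENNReal_le.2 <| (min_le_right _ _).trans_eq ?_
    rw [noiseTime_eq_firstTime P0 P1 hu huK]
  · have hcardB := hcard B
    rw [compl_compl]
    exact minDecisionTime_le_optimalTime_of_notMem hA ⟨by omega, by omega⟩ hj (by simpa using hjB)

end ProposedThresholds

end SeqTest

theorem theorem4p1 {K : ℕ} {S : Fin K → Type*} [∀ k, MeasurableSpace (S k)]
    (P0 P1 : ∀ k, Measure (ℕ → S k))
    [∀ k, IsProbabilityMeasure (P0 k)] [∀ k, IsProbabilityMeasure (P1 k)]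
    (hequiv : ∀ k, LocallyEquivalent (P0 k) (P1 k))
    (I J : Fin K → ℝ) (hI : ∀ k, 0 < I k) (hJ : ∀ k, 0 < J k)
    (hlimsup : ∀ k, LimsupCondition (P0 k) (P1 k) (I k) (J k))
    (hcomplete : ∀ k, CompleteConvergence (P0 k) (P1 k) (I k) (J k))
    (l u : ℕ) (hlu : l ≤ u) (huK : u ≤ K) (hu : 0 < u) (hl : l < K) :
    -- asymptotic optimality for all admissible thresholds
    (∀ a b c d : ℝ → ℝ → ℝ,
      (∀ α ∈ Set.Ioo (0 : ℝ) 1, ∀ β ∈ Set.Ioo (0 : ℝ) 1,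
        0 < a α β ∧ 0 < b α β ∧ 0 < c α β ∧ 0 < d α β ∧
        proposed P0 P1 l u (a α β) (b α β) (c α β) (d α β)
          ∈ errorClass P0 P1 α β (boundedClass K l u)) →
      RealSim a (fun α _ => |Real.log α|) → RealSim c (fun α _ => |Real.log α|) →
      RealSim b (fun _ β => |Real.log β|) → RealSim d (fun _ β => |Real.log β|) →
      ∀ A ∈ boundedClass K l u,
        (∀ i ∈ A,
          Sim (fun α β => expectedTime P0 P1
                (proposed P0 P1 l u (a α β) (b α β) (c α β) (d α β)) i A)
              (fun α β => optimalTime P0 P1 i A α β (boundedClass K l u)) ∧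
          Sim (fun α β => optimalTime P0 P1 i A α β (boundedClass K l u))
              (fun α _ => ENNReal.ofReal |Real.log α| /
                (ENNReal.ofReal (I i) + minNoise J A * (if A.card = l then 1 else 0)))) ∧
        (∀ j ∉ A,
          Sim (fun α β => expectedTime P0 P1
                (proposed P0 P1 l u (a α β) (b α β) (c α β) (d α β)) j A)
              (fun α β => optimalTime P0 P1 j A α β (boundedClass K l u)) ∧
          Sim (fun α β => optimalTime P0 P1 j A α β (boundedClass K l u))
              (fun _ β => ENNReal.ofReal |Real.log β| /
                (ENNReal.ofReal (J j) + minSignal I A * (if A.card = u then 1 else 0))))) ∧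
    -- the explicit thresholds are admissible
    (∀ α ∈ Set.Ioo (0 : ℝ) 1, ∀ β ∈ Set.Ioo (0 : ℝ) 1,
      (l = u → ∀ a b : ℝ,
        proposed P0 P1 l u a b
            (|Real.log α| + Real.log ((l : ℝ) * ((K : ℝ) - l)))
            (|Real.log β| + Real.log ((l : ℝ) * ((K : ℝ) - l)))
          ∈ errorClass P0 P1 α β (boundedClass K l u)) ∧
      (l < u →
        proposed P0 P1 l u
            (|Real.log α| + Real.log K) (|Real.log β| + Real.log K)
            (|Real.log α| + Real.log (((K : ℝ) - l) * K))
            (|Real.log β| + Real.log ((u : ℝ) * K))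
          ∈ errorClass P0 P1 α β (boundedClass K l u))) := by
  refine ⟨fun a b c d hadm ha hc hb hd A hA => ?_, fun α hα β hβ => ⟨?_, fun hlt => ?_⟩⟩
  · have hχ := fun α hα β hβ => (hadm α hα β hβ).2.2.2.2
    exact ⟨fun i hi => sim_expectedTime_proposed_of_mem hequiv hlimsup hcomplete hI hJ hl hχ
        ha hc hA hi,
      fun j hj => sim_expectedTime_proposed_of_notMem hequiv hlimsup hcomplete hI hJ hu huK hχ
        hb hd hA hj⟩
  · rintro rfl
    exact proposed_mem_errorClass_of_card_eq hequiv hcomplete hI hJ hu hl hα hβ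
  · exact proposed_mem_errorClass_of_card_lt hequiv hcomplete hI hJ hlt huK hα hβ
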